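/- There is an absolute constant $C>0$ such that the following holds. Let $d\ge 1$ be an integer, let $\rho>0$ and $0<\varepsilon<M$ be real, put $n=\lceil\log_2(4/\varepsilon)\rceil+\lceil\log_2(3M)\rceil$ and $$G_n^d=\Big\{\tfrac{k}{2^n}+\tfrac1{2^{n+1}} : k\in\mathbb Z,\ -2^{n-1}\le k<2^{n-1}\Big\}^d\subset\mathbb R^d,\qquad Z=\{x+y : x\in G_n^d,\ y\in\{0,1\}^d\}.$$ For $h:\mathbb R^d\to\mathbb R$ let $O_h:|z\rangle\mapsto e^{ih(z)}|z\rangle$ be its phase oracle on $\mathrm{Span}\{|z\rangle : z\in Z\}$. There is a quantum query algorithm, depending only on $d,\rho,\varepsilon,M$ (unitaries independent of the oracle, on the query register and a finite workspace, interleaved with uses of the oracle or of its inverse, then a measurement in the computational basis and a classical function of the outcome), which makes at most $$C\,\frac d\varepsilon\,\max\Big\{1,\log\frac d\rho\Big\}$$ queries to the oracle and its inverse and has the following property. Let $H\in\mathbb R^{d\times d}$ be symmetric with $\|H\|_{\max}=\max_{i,j}|H_{ij}|\le M$, let $c\in\mathbb R$ and $h:\mathbb R^d\to\mathbb R$, and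 suppose that $$\big|h(z)-z^{T}Hz-c\big|\le\frac{\varepsilon}{8\cdot 42\,\pi}$$ for almost all $z\in Z$, that is, for all but at most a $1/1000$ fraction of the points of $Z$. If $\varepsilon\ge 8$, suppose also that $h(Z)\subset[-\pi,\pi]$. Then the algorithm, run with the oracle $O_h$, outputs a matrix $\widetilde H$ such that $\|\widetilde H-H\|_{\max}\le\varepsilon$ with probability at least $1-\rho$. -/

import Mathlib

open scoped Matrix

noncomputable section

namespace QuantumHessian

/-! ### Quantum query algorithms with a phase oracle -/

/-- The phase oracle `O_φ : |x⟩ ↦ e^{iφ(x)}|x⟩` of `φ : X → ℝ`, acting on the first register of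
`Span {|x⟩|w⟩ : x ∈ X, w ∈ W}`. -/
def phaseOracle {X W : Type} [DecidableEq X] [DecidableEq W] (φ : X → ℝ) :
    Matrix (X × W) (X × W) ℂ :=
  Matrix.diagonal fun b => Complex.exp (Complex.I * (φ b.1 : ℂ))

/-- One step of a circuit on the Hilbert space with orthonormal basis `B`: a unitary that does
not depend on the oracle, one use of the oracle, or one use of the inverse of the oracle. -/
inductive Step (B : Type) [Fintype B] [DecidableEq B] where
  | gate (U : Matrix.unitaryGroup B ℂ) : Step B
  | query : Step B
  | queryInv : Step B

/-- A step costs one query if it uses the oracle or its inverse, and none otherwise. -/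
def Step.cost {B : Type} [Fintype B] [DecidableEq B] : Step B → ℕ
  | .gate _ => 0
  | .query => 1
  | .queryInv => 1

/-- The action of a step on a state vector when the oracle is the unitary matrix `O`. -/
def Step.apply {B : Type} [Fintype B] [DecidableEq B] (O : Matrix B B ℂ) :
    Step B → (B → ℂ) → (B → ℂ)
  | .gate U, ψ => (U : Matrix B B ℂ) *ᵥ ψ
  | .query, ψ => O *ᵥ ψ
  | .queryInv, ψ => Oᴴ *ᵥ ψ

/-- A quantum query algorithm with query register `X` and outputs in `R`: a finite workspace, an
initial basis state, a fixed sequence of steps, and a classical function that is applied to the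
outcome of a measurement of all registers in the computational basis.  Nothing in it depends on
the function that the oracle hides. -/
structure QueryAlgorithm (X : Type) [Fintype X] [DecidableEq X] (R : Type) where
  Work : Type
  [fintypeWork : Fintype Work]
  [decidableEqWork : DecidableEq Work]
  init : X × Work
  steps : List (Step (X × Work))
  output : X × Work → R

attribute [instance] QueryAlgorithm.fintypeWork QueryAlgorithm.decidableEqWork

variable {X R : Type} [Fintype X] [DecidableEq X]

/-- The number of queries (uses of the oracle or of its inverse). -/
def QueryAlgorithm.queries (A : QueryAlgorithm X R) : ℕ :=
  (A.steps.map Step.cost).sum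

/-- The state before the measurement when the algorithm is run with the phase oracle of `φ`. -/
def QueryAlgorithm.finalState (A : QueryAlgorithm X R) (φ : X → ℝ) : X × A.Work → ℂ :=
  A.steps.foldl (fun ψ s => s.apply (phaseOracle φ) ψ) (Pi.single A.init 1)

open Classical in
/-- The probability that the output lies in `S`, by the Born rule. -/
def QueryAlgorithm.prob (A : QueryAlgorithm X R) (φ : X → ℝ) (S : Set R) : ℝ :=
  ∑ b, if A.output b ∈ S then ‖A.finalState φ b‖ ^ 2 else 0

/-! ### The sampling points -/

/-- The exponent `n = n_ε + n_M`, with `n_ε = ⌈log₂(4/ε)⌉` and `n_M = ⌈log₂(3M)⌉`. -/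
def gridExponent (ε M : ℝ) : ℕ :=
  (⌈Real.logb 2 (4 / ε)⌉ + ⌈Real.logb 2 (3 * M)⌉).toNat

/-- The conversion to a natural number in `gridExponent` loses nothing. -/
theorem gridExponent_cast {ε M : ℝ} (hε : 0 < ε) (hM : ε < M) :
    (gridExponent ε M : ℤ) = ⌈Real.logb 2 (4 / ε)⌉ + ⌈Real.logb 2 (3 * M)⌉ := by
  have hM0 : 0 < M := hε.trans hM
  have h1 := Int.le_ceil (Real.logb 2 (4 / ε))
  have h2 := Int.le_ceil (Real.logb 2 (3 * M))
  have h3 : 0 ≤ Real.logb 2 (4 / ε) + Real.logb 2 (3 * M) := by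
    rw [← Real.logb_mul (by positivity) (by positivity)]
    apply Real.logb_nonneg (by norm_num)
    rw [div_mul_eq_mul_div, le_div_iff₀ hε]
    linarith
  unfold gridExponent
  rw [Int.toNat_of_nonneg]
  have : (0 : ℝ) ≤ ((⌈Real.logb 2 (4 / ε)⌉ + ⌈Real.logb 2 (3 * M)⌉ : ℤ) : ℝ) := by
    push_cast
    linarith
  exact_mod_cast this

/-- Labels of the points `z = x + y` with `x ∈ G_n^d` and `y ∈ {0,1}^d`. -/
abbrev Label (d n : ℕ) : Type := (Fin d → Fin (2 ^ n)) × (Fin d → Bool)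

/-- The point of the grid `G_n^d` with the label `k`: its coordinates are
`(k_i - 2^{n-1}) / 2^n + 1 / 2^{n+1}` with `0 ≤ k_i < 2^n`. -/
def gridPoint {d n : ℕ} (k : Fin d → Fin (2 ^ n)) : Fin d → ℝ :=
  fun i => (((k i : ℕ) : ℝ) - 2 ^ n / 2) / 2 ^ n + 1 / 2 ^ (n + 1)

/-- The vertex of the cube `{0,1}^d` with the label `b`. -/
def cubePoint {d : ℕ} (b : Fin d → Bool) : Fin d → ℝ :=
  fun i => if b i then 1 else 0

/-- The point `z = x + y` with a given label. -/
def samplePoint {d n : ℕ} (l : Label d n) : Fin d → ℝ :=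
  gridPoint l.1 + cubePoint l.2

/-- Different labels belong to different points, so the basis states `|l⟩` of the query register
are the `|z⟩` with `z ∈ G_n^d + {0,1}^d`. -/
theorem samplePoint_injective {d n : ℕ} :
    Function.Injective (samplePoint : Label d n → Fin d → ℝ) := by
  have key : ∀ (N : ℕ) (k k' : ℕ) (b b' : Bool), k < N → k' < N →
      k + (if b then N else 0) = k' + (if b' then N else 0) → k = k' ∧ b = b' := by
    intro N k k' b b' hk hk' h
    cases b <;> cases b' <;> simp at h ⊢ <;> omega
  have coord : ∀ (l l' : Label d n), samplePoint l = samplePoint l' →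
      ∀ i, l.1 i = l'.1 i ∧ l.2 i = l'.2 i := by
    intro l l' h i
    have hi := congrFun h i
    have hN : (0 : ℝ) < 2 ^ n := by positivity
    simp only [samplePoint, gridPoint, cubePoint, Pi.add_apply] at hi
    have h2 : (((l.1 i : ℕ) + (if l.2 i then 2 ^ n else 0) : ℕ) : ℝ) =
        (((l'.1 i : ℕ) + (if l'.2 i then 2 ^ n else 0) : ℕ) : ℝ) := by
      have e : ∀ (a : ℝ) (b : Bool), (a - 2 ^ n / 2) / 2 ^ n + 1 / 2 ^ (n + 1) +
          (if b then (1 : ℝ) else 0) =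
          (a + (if b then (2 : ℝ) ^ n else 0)) / 2 ^ n + (1 / 2 ^ (n + 1) - 1 / 2) := by
        intro a b
        cases b <;> simp <;> field_simp <;> ring
      rw [e, e] at hi
      have hi' := add_right_cancel hi
      rw [div_left_inj' hN.ne'] at hi'
      push_cast
      exact hi'
    have h3 := key (2 ^ n) _ _ _ _ (l.1 i).isLt (l'.1 i).isLt (by exact_mod_cast h2)
    exact ⟨Fin.ext h3.1, h3.2⟩
  intro l l' h
  exact Prod.ext (funext fun i => (coord l l' h i).1) (funext fun i => (coord l l' h i).2)

/-- `P` holds at almost all points of a finite set: at all but a `1/1000` fraction of them. -/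
def AlmostAll {α : Type} [Fintype α] (P : α → Prop) : Prop :=
  ({a | ¬ P a}.ncard : ℝ) ≤ 1 / 1000 * (Fintype.card α : ℝ)

/-! ### Matrices -/

/-- The max norm `‖A‖_max = max_{i,j} |a_ij|`. -/
def maxNorm {d : ℕ} (A : Matrix (Fin d) (Fin d) ℝ) : ℝ :=
  ⨆ p : Fin d × Fin d, |A p.1 p.2|

theorem maxNorm_le_iff {d : ℕ} {A : Matrix (Fin d) (Fin d) ℝ} {r : ℝ} (hr : 0 ≤ r) :
    maxNorm A ≤ r ↔ ∀ i j, |A i j| ≤ r := by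
  constructor
  · intro h i j
    exact (le_ciSup (f := fun p : Fin d × Fin d => |A p.1 p.2|)
      (Set.finite_range _).bddAbove (i, j)).trans h
  · intro h
    exact Real.iSup_le (fun p => h p.1 p.2) hr

end QuantumHessian

end

/-!
The difference structure of a quadratic form turns Hessian learning into phase estimation.
If `z'` is `z` moved along the `j`-th edge of the cube `{0,1}^d`, then
`zᵀHz - z'ᵀHz' = ± 2 ∑ i, H i j * x i` up to a term that does not depend on the grid point `x`
(`quadraticValue_sub_flipBit`). With `q = ⌈π / ε⌉` uses of the inverse oracle at `z'` and of the
oracle at `z`, the uniform superposition of all labels acquires a phase that is linear in `x`, so it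
becomes a superposition over `y` of products of plane waves, and the inverse Fourier transform in
the `i`-th grid register shows `± q H i j / π`, rounded to a neighbouring integer, with probability
at least `2/3` (`two_thirds_le_sum_fourierAmplitude`). One unit of this number is `π / q ≤ ε` in
`H i j`, and `12 M / ε ≤ 2 ^ n` excludes a wrap-around modulo `2 ^ n`.

Since `y` is in uniform superposition too, both `z` and `z'` are uniformly distributed over the
sample points. Hence the points where the hypothesis on `h` fails carry at most `2/1000` of the
squared norm, and at the other points the phase is off by at most `1/20`: the true state is close
to the ideal one in norm, and each entry of the `j`-th column is still wrong with probability at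
most `47/100` (`sum_bad_columnRun_le`). The runs are made independent by moving the result of each
to a register of its own (`prob_independentRuns`). For every column there are `m = O(log (d / ρ))`
runs, an entrywise median is taken, and a Chernoff bound with a union bound over the `d²` entries
finishes the argument (`le_prob_medianEstimate`).

For `ε ≥ 13` the query budget may be smaller than one. There `h` is bounded by `π`, and a second
difference of `h` in the directions `i` and `j` shows that the zero matrix is a correct answer
(`abs_entry_le_of_bounded`).
-/

namespace QuantumHessian

/-! ### Independent runs of a quantum subroutine -/

open scoped Kronecker

section Registers

variable {X W : Type} [Fintype X] [DecidableEq X] [Fintype W] [DecidableEq W]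

/-- The product state `f ⊗ g` of two registers. -/
def tensorState (f : X → ℂ) (g : W → ℂ) : X × W → ℂ := fun p => f p.1 * g p.2

/-- The gate `U ⊗ 1` that acts with `U` on the query register and leaves the workspace alone. -/
noncomputable def liftGate (W : Type) [Fintype W] [DecidableEq W]
    (U : Matrix.unitaryGroup X ℂ) : Matrix.unitaryGroup (X × W) ℂ :=
  ⟨(U : Matrix X X ℂ) ⊗ₖ (1 : Matrix W W ℂ), Matrix.kronecker_mem_unitary U.2 (one_mem _)⟩

/-- The gate that permutes the basis states by `e`; it sends the amplitude function `ψ` to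
`ψ ∘ e`. -/
noncomputable def permGate (e : Equiv.Perm X) : Matrix.unitaryGroup X ℂ :=
  ⟨e.permMatrix ℂ, by
    rw [Matrix.mem_unitaryGroup_iff, Matrix.star_eq_conjTranspose, Matrix.conjTranspose_permMatrix,
      ← Matrix.permMatrix_mul]
    simp⟩

/-- The phase oracle of `φ` on the query register alone. -/
noncomputable def queryOracle (φ : X → ℝ) : Matrix X X ℂ :=
  Matrix.diagonal fun x => Complex.exp (Complex.I * (φ x : ℂ))

/-- A step on the query register, extended by the identity on the workspace. -/
noncomputable def Step.lift (W : Type) [Fintype W] [DecidableEq W] : Step X → Step (X × W)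
  | .gate U => .gate (liftGate W U)
  | .query => .query
  | .queryInv => .queryInv

theorem Step.cost_lift (s : Step X) : (s.lift W).cost = s.cost := by
  cases s <;> rfl

theorem liftGate_mulVec (U : Matrix.unitaryGroup X ℂ) (f : X → ℂ) (g : W → ℂ) :
    (liftGate W U : Matrix (X × W) (X × W) ℂ) *ᵥ tensorState f g =
      tensorState ((U : Matrix X X ℂ) *ᵥ f) g := by
  ext ⟨x, w⟩
  simp [liftGate, tensorState, Matrix.mulVec, dotProduct, Fintype.sum_prod_type,
    Matrix.one_apply, Finset.sum_mul, mul_assoc]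

theorem phaseOracle_mulVec (φ : X → ℝ) (f : X → ℂ) (g : W → ℂ) :
    (phaseOracle φ : Matrix (X × W) (X × W) ℂ) *ᵥ tensorState f g =
      tensorState (queryOracle φ *ᵥ f) g := by
  ext ⟨x, w⟩
  simp [phaseOracle, queryOracle, tensorState, Matrix.mulVec_diagonal, mul_assoc]

theorem phaseOracle_conjTranspose_mulVec (φ : X → ℝ) (f : X → ℂ) (g : W → ℂ) :
    (phaseOracle φ : Matrix (X × W) (X × W) ℂ)ᴴ *ᵥ tensorState f g =
      tensorState ((queryOracle φ)ᴴ *ᵥ f) g := by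
  ext ⟨x, w⟩
  simp [phaseOracle, queryOracle, tensorState, Matrix.mulVec_diagonal, mul_assoc,
    Matrix.diagonal_conjTranspose]

theorem Step.lift_apply (φ : X → ℝ) (s : Step X) (f : X → ℂ) (g : W → ℂ) :
    (s.lift W).apply (phaseOracle φ) (tensorState f g) =
      tensorState (s.apply (queryOracle φ) f) g := by
  cases s with
  | gate U => exact liftGate_mulVec U f g
  | query => exact phaseOracle_mulVec φ f g
  | queryInv => exact phaseOracle_conjTranspose_mulVec φ f g

/-- The state that the steps `L` on the query register produce from `ψ`. -/
noncomputable def runState (φ : X → ℝ) (L : List (Step X)) (ψ : X → ℂ) : X → ℂ :=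
  L.foldl (fun ψ s => s.apply (queryOracle φ) ψ) ψ

theorem foldl_lift (φ : X → ℝ) (L : List (Step X)) (f : X → ℂ) (g : W → ℂ) :
    (L.map (Step.lift W)).foldl (fun ψ s => s.apply (phaseOracle φ) ψ) (tensorState f g) =
      tensorState (runState φ L f) g := by
  induction L generalizing f with
  | nil => rfl
  | cons s L ih =>
    rw [List.map_cons, List.foldl_cons, Step.lift_apply, ih]
    rfl

end Registers

section Repetition

variable {X R ι : Type} [Fintype X] [DecidableEq X] [Fintype ι] [DecidableEq ι]

/-- The exchange of the query register with the workspace register `t`. -/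
def swapRegister (t : ι) : Equiv.Perm (X × (ι → X)) where
  toFun p := (p.2 t, Function.update p.2 t p.1)
  invFun p := (p.2 t, Function.update p.2 t p.1)
  left_inv p := by simp
  right_inv p := by simp

/-- The runs `P t`, `t ∈ L`, one after the other. Each starts from a clean query register, and its
final state is moved to the workspace register `t`. -/
noncomputable def repeatedSteps (P : ι → List (Step X)) (L : List ι) :
    List (Step (X × (ι → X))) :=
  L.flatMap fun t => (P t).map (Step.lift (ι → X)) ++ [.gate (permGate (swapRegister t))]

/-- The query algorithm that performs the runs `P t`, each on its own copy of the initial state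
`x₀`, measures all of them, and applies `out` to the outcomes. -/
noncomputable def independentRuns (P : ι → List (Step X)) (x₀ : X) (out : (ι → X) → R) :
    QueryAlgorithm X R where
  Work := ι → X
  init := (x₀, fun _ => x₀)
  steps := repeatedSteps P Finset.univ.toList
  output p := out p.2

/-- Exchanging a query register in state `χ` with a clean workspace register stores `χ` there and
leaves the query register clean. -/
theorem permGate_swapRegister_mulVec (t : ι) (x₀ : X) (χ : X → ℂ) (f : ι → X → ℂ)
    (hf : f t = Pi.single x₀ 1) :
    (permGate (X := X × (ι → X)) (swapRegister t)).1 *ᵥ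
        tensorState χ (fun w => ∏ s, f s (w s)) =
      tensorState (Pi.single x₀ 1) (fun w => ∏ s, Function.update f t χ s (w s)) := by
  ext ⟨x, w⟩
  have h1 : ∏ s, f s (Function.update w t x s) =
      (Pi.single x₀ 1 : X → ℂ) x * ∏ s ∈ Finset.univ.erase t, f s (w s) := by
    rw [← Finset.mul_prod_erase _ _ (Finset.mem_univ t), Function.update_self, hf]
    congr 1
    refine Finset.prod_congr rfl fun s hs => ?_
    rw [Function.update_of_ne (Finset.ne_of_mem_erase hs)]
  have h2 : ∏ s, Function.update f t χ s (w s) =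
      χ (w t) * ∏ s ∈ Finset.univ.erase t, f s (w s) := by
    rw [← Finset.mul_prod_erase _ _ (Finset.mem_univ t), Function.update_self]
    congr 1
    refine Finset.prod_congr rfl fun s hs => ?_
    rw [Function.update_of_ne (Finset.ne_of_mem_erase hs)]
  have h3 : (permGate (X := X × (ι → X)) (swapRegister t)).1 *ᵥ
      tensorState χ (fun w => ∏ s, f s (w s)) =
      tensorState χ (fun w => ∏ s, f s (w s)) ∘ swapRegister t :=
    Matrix.permMatrix_mulVec _
  rw [h3]
  simp only [tensorState, Function.comp_apply, swapRegister, Equiv.coe_fn_mk, h1, h2]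
  ring

/-- Starting from clean registers, the runs in `L` leave a product state: register `s` holds the final
state of the run `s` if `s ∈ L`, and is untouched otherwise. -/
theorem foldl_repeatedSteps (φ : X → ℝ) (P : ι → List (Step X)) (x₀ : X) (L : List ι)
    (hL : L.Nodup) (f : ι → X → ℂ) (hf : ∀ t ∈ L, f t = Pi.single x₀ 1) :
    (repeatedSteps P L).foldl (fun ψ s => s.apply (phaseOracle φ) ψ)
        (tensorState (Pi.single x₀ 1) fun w => ∏ s, f s (w s)) =
      tensorState (Pi.single x₀ 1) fun w => ∏ s,
        (if s ∈ L then runState φ (P s) (Pi.single x₀ 1) else f s) (w s) := by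
  induction L generalizing f with
  | nil => simp [repeatedSteps]
  | cons t L ih =>
    obtain ⟨htL, hL'⟩ := List.nodup_cons.mp hL
    rw [repeatedSteps, List.flatMap_cons, List.foldl_append, List.foldl_append, foldl_lift,
      List.foldl_cons, List.foldl_nil, Step.apply,
      permGate_swapRegister_mulVec t x₀ _ f (hf t (by simp))]
    have := ih hL' (Function.update f t (runState φ (P t) (Pi.single x₀ 1))) fun s hs => by
      rw [Function.update_of_ne (by rintro rfl; exact htL hs)]
      exact hf s (List.mem_cons_of_mem _ hs)
    rw [repeatedSteps] at this
    rw [this]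
    congr 1
    ext w
    refine Finset.prod_congr rfl fun s _ => ?_
    by_cases hst : s = t
    · subst hst
      simp [htL]
    · simp [hst]

theorem queries_independentRuns (P : ι → List (Step X)) (x₀ : X) (out : (ι → X) → R) :
    (independentRuns P x₀ out).queries = ∑ t, ((P t).map Step.cost).sum := by
  have key : ∀ L : List ι, ((repeatedSteps P L).map Step.cost).sum =
      (L.map fun t => ((P t).map Step.cost).sum).sum := by
    intro L
    induction L with
    | nil => rfl
    | cons t L ih =>
      have : Step.cost ∘ Step.lift (X := X) (ι → X) = Step.cost := funext Step.cost_lift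
      rw [repeatedSteps] at ih ⊢
      simp [ih, Step.cost, this]
  rw [QueryAlgorithm.queries]
  exact (key _).trans (Finset.sum_map_toList _ _)

open Classical in
/-- The outcomes of the runs are independent. -/
theorem prob_independentRuns (P : ι → List (Step X)) (x₀ : X) (out : (ι → X) → R) (φ : X → ℝ)
    (S : Set R) :
    (independentRuns P x₀ out).prob φ S = ∑ w : ι → X,
      if out w ∈ S then ∏ t, ‖runState φ (P t) (Pi.single x₀ 1) (w t)‖ ^ 2 else 0 := by
  have hinit : (Pi.single (x₀, fun _ => x₀) 1 : X × (ι → X) → ℂ) =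
      tensorState (Pi.single x₀ 1) fun w => ∏ s, (Pi.single x₀ 1 : X → ℂ) (w s) := by
    ext ⟨x, w⟩
    by_cases hx : x = x₀
    · by_cases hw : w = fun _ => x₀
      · simp [tensorState, hx, hw]
      · have : ∃ s, w s ≠ x₀ := by
          by_contra! h
          exact hw (funext h)
        obtain ⟨s, hs⟩ := this
        have h0 : ∏ s, (Pi.single x₀ 1 : X → ℂ) (w s) = 0 :=
          Finset.prod_eq_zero (Finset.mem_univ s) (by simp [hs])
        simp only [tensorState]
        rw [h0, mul_zero, Pi.single_eq_of_ne]
        exact fun h => hw (congrArg Prod.snd h)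
    · simp [tensorState, hx, Pi.single_apply]
  have hfinal : (independentRuns P x₀ out).finalState φ =
      tensorState (Pi.single x₀ 1) fun w => ∏ t, runState φ (P t) (Pi.single x₀ 1) (w t) := by
    have := foldl_repeatedSteps φ P x₀ Finset.univ.toList (Finset.nodup_toList _)
      (fun _ => Pi.single x₀ 1) (fun _ _ => rfl)
    simp only [Finset.mem_toList, Finset.mem_univ, if_true] at this
    rw [← hinit] at this
    exact this
  have hsum : (independentRuns P x₀ out).prob φ S = ∑ p : X × (ι → X), if out p.2 ∈ S then
      ‖tensorState (Pi.single x₀ 1)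
        (fun w => ∏ t, runState φ (P t) (Pi.single x₀ 1) (w t)) p‖ ^ 2 else 0 := by
    change (∑ p : X × (ι → X), if out p.2 ∈ S then
      ‖(independentRuns P x₀ out).finalState φ p‖ ^ 2 else 0) = _
    rw [hfinal]
    rfl
  rw [hsum, Fintype.sum_prod_type, Finset.sum_eq_single x₀]
  · simp [tensorState, Finset.prod_pow]
  · intro x _ hx
    simp [tensorState, hx]
  · simp

end Repetition

/-- Any unit vector can be prepared from any basis state. -/
theorem exists_unitary_mulVec_single {X : Type} [Fintype X] [DecidableEq X] (x₀ : X) (v : X → ℂ)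
    (hv : ∑ x, ‖v x‖ ^ 2 = 1) :
    ∃ U : Matrix.unitaryGroup X ℂ, (U : Matrix X X ℂ) *ᵥ Pi.single x₀ 1 = v := by
  let u : X → EuclideanSpace ℂ X := fun _ => WithLp.toLp 2 v
  have hu : Orthonormal ℂ (({x₀} : Set X).domRestrict u) := by
    rw [orthonormal_iff_ite]
    intro i j
    rw [if_pos (Subsingleton.elim i j)]
    change inner ℂ (WithLp.toLp 2 v : EuclideanSpace ℂ X) (WithLp.toLp 2 v) = 1
    rw [inner_self_eq_norm_sq_to_K, ← RCLike.ofReal_pow, EuclideanSpace.norm_sq_eq]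
    simp [hv]
  obtain ⟨b, hb⟩ := hu.exists_orthonormalBasis_extension_of_card_eq (by simp)
  refine ⟨⟨(EuclideanSpace.basisFun X ℂ).toBasis.toMatrix b,
    (EuclideanSpace.basisFun X ℂ).toMatrix_orthonormalBasis_mem_unitary b⟩, ?_⟩
  ext x
  simp [Module.Basis.toMatrix_apply, hb x₀ rfl, u]

theorem sum_norm_sq_unitary_mulVec {X : Type} [Fintype X] [DecidableEq X]
    (U : Matrix.unitaryGroup X ℂ) (v : X → ℂ) :
    ∑ x, ‖((U : Matrix X X ℂ) *ᵥ v) x‖ ^ 2 = ∑ x, ‖v x‖ ^ 2 := by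
  have key : ∀ w : X → ℂ, ((∑ x, ‖w x‖ ^ 2 : ℝ) : ℂ) = star w ⬝ᵥ w := by
    intro w
    simp [dotProduct, Complex.conj_mul']
  have hU : (U : Matrix X X ℂ)ᴴ * (U : Matrix X X ℂ) = 1 := Matrix.mem_unitaryGroup_iff'.mp U.2
  have : ((∑ x, ‖((U : Matrix X X ℂ) *ᵥ v) x‖ ^ 2 : ℝ) : ℂ) = ((∑ x, ‖v x‖ ^ 2 : ℝ) : ℂ) := by
    rw [key, key, Matrix.star_mulVec, Matrix.dotProduct_mulVec, Matrix.vecMul_vecMul, hU,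
      Matrix.vecMul_one]
  exact_mod_cast this

/-! ### Medians and majorities of independent trials -/

theorem exists_median {m : ℕ} (x : Fin m → ℝ) :
    ∃ v, 2 * (Finset.univ.filter fun r => x r < v).card ≤ m ∧
      2 * (Finset.univ.filter fun r => v < x r).card ≤ m := by
  rcases Nat.eq_zero_or_pos m with rfl | hm
  · exact ⟨0, by simp, by simp⟩
  have : Nonempty (Fin m) := ⟨⟨0, hm⟩⟩
  let S := Finset.univ.filter fun r => m ≤ 2 * (Finset.univ.filter fun s => x s ≤ x r).card
  have hS : S.Nonempty := by
    obtain ⟨r, hr⟩ := Finite.exists_max x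
    refine ⟨r, Finset.mem_filter.mpr ⟨Finset.mem_univ _, ?_⟩⟩
    rw [Finset.filter_true_of_mem fun s _ => hr s, Finset.card_univ, Fintype.card_fin]
    omega
  obtain ⟨r, hrS, hr⟩ := S.exists_min_image x hS
  have hrS' := (Finset.mem_filter.mp hrS).2
  refine ⟨x r, ?_, ?_⟩
  · by_contra! hlt
    have hne : (Finset.univ.filter fun s => x s < x r).Nonempty := by
      rw [← Finset.card_pos]
      omega
    obtain ⟨t, ht, hmax⟩ := Finset.exists_max_image _ x hne
    have htr := (Finset.mem_filter.mp ht).2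
    have hsub : (Finset.univ.filter fun s => x s < x r).card ≤
        (Finset.univ.filter fun s => x s ≤ x t).card :=
      Finset.card_le_card fun s hs => Finset.mem_filter.mpr ⟨Finset.mem_univ _, hmax s hs⟩
    have htS : t ∈ S := Finset.mem_filter.mpr ⟨Finset.mem_univ _, by omega⟩
    exact absurd (hr t htS) (not_le.mpr htr)
  · have h := Finset.card_filter_add_card_filter_not (s := (Finset.univ : Finset (Fin m)))
      (fun s => x s ≤ x r)
    simp only [not_le, Finset.card_univ, Fintype.card_fin] at h
    omega

/-- A median of finitely many real numbers. -/
noncomputable def median {m : ℕ} (x : Fin m → ℝ) : ℝ := (exists_median x).choose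

open Classical in
theorem abs_median_sub_le {m : ℕ} (x : Fin m → ℝ) (a ε : ℝ)
    (h : 2 * (Finset.univ.filter fun r => ¬ |x r - a| ≤ ε).card < m) : |median x - a| ≤ ε := by
  obtain ⟨h1, h2⟩ := (exists_median x).choose_spec
  change 2 * (Finset.univ.filter fun r => x r < median x).card ≤ m at h1
  change 2 * (Finset.univ.filter fun r => median x < x r).card ≤ m at h2
  have hc := Finset.card_filter_add_card_filter_not (s := (Finset.univ : Finset (Fin m)))
      (fun r => |x r - a| ≤ ε)
  rw [Finset.card_univ, Fintype.card_fin] at hc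
  rw [abs_le]
  constructor
  · by_contra! hlt
    have hsub : (Finset.univ.filter fun r => |x r - a| ≤ ε).card ≤
        (Finset.univ.filter fun r => median x < x r).card := by
      refine Finset.card_le_card fun r hr => ?_
      rw [Finset.mem_filter] at hr ⊢
      exact ⟨hr.1, by linarith [(abs_le.mp hr.2).1]⟩
    omega
  · by_contra! hlt
    have hsub : (Finset.univ.filter fun r => |x r - a| ≤ ε).card ≤
        (Finset.univ.filter fun r => x r < median x).card := by
      refine Finset.card_le_card fun r hr => ?_
      rw [Finset.mem_filter] at hr ⊢
      exact ⟨hr.1, by linarith [(abs_le.mp hr.2).2]⟩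
    omega

section Chernoff

variable {X I J : Type} [Fintype X] [Fintype I] [Fintype J] [DecidableEq J]

open Classical in
/-- If an event has probability at most `47/100`, then it occurs in at least half of `m`
independent trials with exponentially small probability. The runs are indexed by `J × Fin m`, and
only those in the block `j` are counted. -/
theorem sum_half_bad_le {m : ℕ} (p : J → X → ℝ) (hp0 : ∀ j x, 0 ≤ p j x)
    (hp1 : ∀ j, ∑ x, p j x = 1) (B : X → Prop) (j : J)
    (hB : (∑ x, if B x then p j x else 0) ≤ 47 / 100) :
    (∑ w : J × Fin m → X, if m ≤ 2 * (Finset.univ.filter fun r => B (w (j, r))).card then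
      ∏ t, p t.1 (w t) else 0) ≤ (999 / 1000 : ℝ) ^ m := by
  -- The moment generating function of (bad runs) - (good runs) at `log (21 / 20)`.
  let c : X → ℝ := fun x => if B x then 21 / 20 else 20 / 21
  let F : J × Fin m → X → ℝ := fun t x => p t.1 x * if t.1 = j then c x else 1
  have hc0 : ∀ x, 0 < c x := fun x => by
    dsimp only [c]
    split_ifs <;> norm_num
  have hF0 : ∀ t x, 0 ≤ F t x := fun t x => mul_nonneg (hp0 _ _) (by
    split_ifs
    exacts [(hc0 x).le, zero_le_one])
  have hprod : ∀ w : J × Fin m → X, ∏ t, F t (w t) =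
      (∏ t, p t.1 (w t)) * ∏ r, c (w (j, r)) := by
    intro w
    rw [Finset.prod_mul_distrib]
    congr 1
    rw [Fintype.prod_prod_type, Finset.prod_eq_single j]
    · simp
    · intro k _ hk
      simp [hk]
    · simp
  have hcprod : ∀ w : J × Fin m → X,
      m ≤ 2 * (Finset.univ.filter fun r => B (w (j, r))).card → 1 ≤ ∏ r, c (w (j, r)) := by
    intro w hw
    have hcard := Finset.card_filter_add_card_filter_not (s := (Finset.univ : Finset (Fin m)))
      (fun r => B (w (j, r)))
    rw [Finset.card_univ, Fintype.card_fin] at hcard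
    dsimp only [c]
    rw [Finset.prod_ite, Finset.prod_const, Finset.prod_const]
    have hle : (Finset.univ.filter fun r => ¬ B (w (j, r))).card ≤
        (Finset.univ.filter fun r => B (w (j, r))).card := by omega
    calc (1 : ℝ) = (21 / 20) ^ (Finset.univ.filter fun r => ¬ B (w (j, r))).card *
          (20 / 21) ^ (Finset.univ.filter fun r => ¬ B (w (j, r))).card := by
          rw [← mul_pow]
          norm_num
      _ ≤ _ := by
          gcongr
          norm_num
  have hstep : (∑ w : J × Fin m → X,
      if m ≤ 2 * (Finset.univ.filter fun r => B (w (j, r))).card then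
        ∏ t, p t.1 (w t) else 0) ≤ ∑ w : J × Fin m → X, ∏ t, F t (w t) := by
    refine Finset.sum_le_sum fun w _ => ?_
    split_ifs with hw
    · rw [hprod]
      exact le_mul_of_one_le_right (Finset.prod_nonneg fun t _ => hp0 _ _) (hcprod w hw)
    · exact Finset.prod_nonneg fun t _ => hF0 _ _
  refine hstep.trans ?_
  rw [← Fintype.prod_sum, Fintype.prod_prod_type, Finset.prod_eq_single j]
  · have hmean : ∑ x, p j x * c x ≤ 999 / 1000 := by
      have : ∀ x, p j x * c x =
          20 / 21 * p j x + (21 / 20 - 20 / 21) * (if B x then p j x else 0) := by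
        intro x
        dsimp only [c]
        split_ifs <;> ring
      simp only [this, Finset.sum_add_distrib, ← Finset.mul_sum, hp1]
      linarith
    have hpos : 0 ≤ ∑ x, p j x * c x :=
      Finset.sum_nonneg fun x _ => mul_nonneg (hp0 _ _) (hc0 x).le
    simp only [F, if_true, Finset.prod_const, Finset.card_univ, Fintype.card_fin]
    exact pow_le_pow_left₀ hpos hmean m
  · intro k _ hk
    simp [F, hk, hp1]
  · simp

open Classical in
/-- Majority votes over `m` independent runs: all events `B i j` are simultaneously in the minority
except with probability `|I| |J| (999/1000)^m`. -/
theorem le_sum_majority {m : ℕ} (p : J → X → ℝ) (hp0 : ∀ j x, 0 ≤ p j x)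
    (hp1 : ∀ j, ∑ x, p j x = 1) (B : I → J → X → Prop)
    (hB : ∀ i j, (∑ x, if B i j x then p j x else 0) ≤ 47 / 100) (G : (J × Fin m → X) → Prop)
    (hG : ∀ w, (∀ i j, 2 * (Finset.univ.filter fun r => B i j (w (j, r))).card < m) → G w) :
    1 - Fintype.card I * Fintype.card J * (999 / 1000 : ℝ) ^ m ≤
      ∑ w : J × Fin m → X, if G w then ∏ t, p t.1 (w t) else 0 := by
  have htot : ∑ w : J × Fin m → X, ∏ t, p t.1 (w t) = 1 := by
    rw [← Fintype.prod_sum]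
    simp [hp1]
  have hpt : ∀ w : J × Fin m → X, ∏ t, p t.1 (w t) ≤
      (if G w then ∏ t, p t.1 (w t) else 0) + ∑ i : I, ∑ j : J,
        if m ≤ 2 * (Finset.univ.filter fun r => B i j (w (j, r))).card then
          ∏ t, p t.1 (w t) else 0 := by
    intro w
    have h0 : 0 ≤ ∏ t, p t.1 (w t) := Finset.prod_nonneg fun t _ => hp0 _ _
    have hterm : ∀ i : I, ∀ j : J,
        0 ≤ if m ≤ 2 * (Finset.univ.filter fun r => B i j (w (j, r))).card then
          ∏ t, p t.1 (w t) else 0 := fun i j => by split_ifs <;> simp [h0]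
    by_cases hw : ∀ i j, 2 * (Finset.univ.filter fun r => B i j (w (j, r))).card < m
    · rw [if_pos (hG w hw)]
      exact le_add_of_nonneg_right (Finset.sum_nonneg fun i _ => Finset.sum_nonneg fun j _ =>
        hterm i j)
    · push Not at hw
      obtain ⟨i, j, hij⟩ := hw
      have h1 : 0 ≤ if G w then ∏ t, p t.1 (w t) else 0 := by split_ifs <;> simp [h0]
      have h2 := Finset.single_le_sum (f := fun j : J =>
        if m ≤ 2 * (Finset.univ.filter fun r => B i j (w (j, r))).card then
          ∏ t, p t.1 (w t) else 0) (fun j _ => hterm i j) (Finset.mem_univ j)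
      have h3 := Finset.single_le_sum (f := fun i : I => ∑ j : J,
        if m ≤ 2 * (Finset.univ.filter fun r => B i j (w (j, r))).card then
          ∏ t, p t.1 (w t) else 0) (fun i _ => Finset.sum_nonneg fun j _ => hterm i j)
        (Finset.mem_univ i)
      simp only [if_pos hij] at h2
      linarith
  have hsum := Finset.sum_le_sum fun w (_ : w ∈ Finset.univ) => hpt w
  rw [htot, Finset.sum_add_distrib, Finset.sum_comm] at hsum
  have hbad : ∑ i : I, ∑ w : J × Fin m → X, ∑ j : J,
      (if m ≤ 2 * (Finset.univ.filter fun r => B i j (w (j, r))).card then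
        ∏ t, p t.1 (w t) else 0) ≤ Fintype.card I * Fintype.card J * (999 / 1000 : ℝ) ^ m := by
    calc _ ≤ ∑ i : I, ∑ j : J, (999 / 1000 : ℝ) ^ m := by
          refine Finset.sum_le_sum fun i _ => ?_
          rw [Finset.sum_comm]
          exact Finset.sum_le_sum fun j _ => sum_half_bad_le p hp0 hp1 (B i j) j (hB i j)
      _ = _ := by simp [mul_assoc]
  linarith

end Chernoff

/-! ### The amplitudes of phase estimation -/

/-- The two integers nearest to a real number carry two thirds of the `sinc²` mass. -/
theorem two_thirds_le_sinc_sq_add {s : ℝ} (hs0 : 0 < s) (hs1 : s < 1) :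
    2 / 3 ≤ (Real.sin (Real.pi * s) / (Real.pi * s)) ^ 2 +
      (Real.sin (Real.pi * s) / (Real.pi * (1 - s))) ^ 2 := by
  have key : ∀ t : ℝ, 0 < t → t ≤ 1 / 2 →
      2 / 3 ≤ (Real.sin (Real.pi * t) / (Real.pi * t)) ^ 2 +
        (Real.sin (Real.pi * t) / (Real.pi * (1 - t))) ^ 2 := by
    intro t ht0 ht1
    have hpi := Real.pi_pos
    have hpi2 : Real.pi ^ 2 < 9.8697 := by nlinarith [Real.pi_lt_d4, Real.pi_gt_d4]
    have hx : 0 < Real.pi * t := by positivity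
    have h1t : 0 < 1 - t := by linarith
    have hsin : 1 - 1.645 * t ^ 2 ≤ Real.sin (Real.pi * t) / (Real.pi * t) := by
      rw [le_div_iff₀ hx]
      have := Real.sin_ge_sub_cube hx.le
      have h2 : (Real.pi * t) ^ 3 / 6 ≤ 1.645 * t ^ 2 * (Real.pi * t) := by
        have : 0 ≤ t ^ 2 * (Real.pi * t) := by positivity
        nlinarith
      linarith
    have hlow : 0 ≤ 1 - 1.645 * t ^ 2 := by nlinarith
    have hsq := pow_le_pow_left₀ hlow hsin 2
    have heq : (Real.sin (Real.pi * t) / (Real.pi * (1 - t))) ^ 2 =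
        (Real.sin (Real.pi * t) / (Real.pi * t)) ^ 2 * (t / (1 - t)) ^ 2 := by
      field_simp
    rw [heq]
    set A := (Real.sin (Real.pi * t) / (Real.pi * t)) ^ 2
    have hB : 2 / 3 ≤ (1 - 1.645 * t ^ 2) ^ 2 * (1 + (t / (1 - t)) ^ 2) := by
      rw [div_pow, one_add_div (by positivity), ← mul_div_assoc, le_div_iff₀ (by positivity)]
      nlinarith [sq_nonneg (t ^ 2), sq_nonneg (t * (1 - 2 * t)),
        mul_nonneg ht0.le (sub_nonneg.2 ht1), sq_nonneg (t - 1 / 2),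
        mul_nonneg (sq_nonneg t) (sub_nonneg.2 ht1),
        mul_nonneg (pow_nonneg ht0.le 3) (sub_nonneg.2 ht1),
        mul_nonneg (pow_nonneg ht0.le 4) (sub_nonneg.2 ht1)]
    have : 0 ≤ (t / (1 - t)) ^ 2 := by positivity
    nlinarith
  rcases le_total s (1 / 2) with h | h
  · exact key s hs0 h
  · have h2 := key (1 - s) (by linarith) (by linarith)
    rw [show Real.pi * (1 - s) = Real.pi - Real.pi * s by ring, Real.sin_pi_sub] at h2
    rw [show Real.pi * (1 - s) = Real.pi - Real.pi * s by ring]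
    rw [show Real.pi * (1 - (1 - s)) = Real.pi * s by ring] at h2
    linarith

/-- The amplitude of the outcome `k` when the Fourier transform on `ℤ/N` is applied to the uniform
superposition with phases `e^{2πiκx/N}`. -/
noncomputable def fourierAmplitude (N : ℕ) (κ k : ℝ) : ℂ :=
  (1 / N : ℂ) * ∑ x : Fin N, Complex.exp (Complex.I * (2 * Real.pi * (κ - k) * (x : ℕ) / N : ℝ))

theorem fourierAmplitude_self (N : ℕ) (hN : 0 < N) (κ : ℝ) : fourierAmplitude N κ κ = 1 := by
  have : (N : ℂ) ≠ 0 := by exact_mod_cast hN.ne'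
  simp [fourierAmplitude, this]

theorem fourierAmplitude_sub_natCast (N : ℕ) (hN : 0 < N) (κ k : ℝ) :
    fourierAmplitude N κ (k - N) = fourierAmplitude N κ k := by
  unfold fourierAmplitude
  congr 1
  refine Finset.sum_congr rfl fun x _ => ?_
  have hN' : (N : ℝ) ≠ 0 := by exact_mod_cast hN.ne'
  have : (2 * Real.pi * (κ - (k - N)) * (x : ℕ) / N : ℝ) =
      2 * Real.pi * (κ - k) * (x : ℕ) / N + (x : ℕ) * (2 * Real.pi) := by
    field_simp
    ring
  rw [this]
  push_cast
  rw [mul_add, Complex.exp_add,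
    show Complex.I * ((x : ℕ) * (2 * Real.pi) : ℂ) = (x : ℕ) * (2 * Real.pi * Complex.I) by ring,
    Complex.exp_nat_mul_two_pi_mul_I, mul_one]

/-- The geometric sum and `|sin θ| ≤ |θ|` bound the amplitude from below by `sinc`. -/
theorem sinc_le_norm_fourierAmplitude (N : ℕ) (hN : 0 < N) (κ k : ℝ) (hne : κ ≠ k) :
    |Real.sin (Real.pi * (κ - k)) / (Real.pi * (κ - k))| ≤ ‖fourierAmplitude N κ k‖ := by
  have hN' : (0 : ℝ) < N := by exact_mod_cast hN
  set u := κ - k with hu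
  have hu0 : u ≠ 0 := sub_ne_zero.mpr hne
  have hpi := Real.pi_pos
  let θ : ℝ := 2 * Real.pi * u / N
  let z : ℂ := Complex.exp (Complex.I * (θ : ℂ))
  have hsum : ∑ x : Fin N, Complex.exp (Complex.I * (2 * Real.pi * u * (x : ℕ) / N : ℝ)) =
      ∑ x ∈ Finset.range N, z ^ x := by
    rw [Finset.sum_range]
    refine Finset.sum_congr rfl fun x _ => ?_
    rw [← Complex.exp_nat_mul]
    congr 1
    simp only [θ]
    push_cast
    ring
  have hmul : ‖∑ x ∈ Finset.range N, z ^ x‖ * ‖z - 1‖ = ‖z ^ N - 1‖ := by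
    rw [← norm_mul, geom_sum_mul]
  have hzN : ‖z ^ N - 1‖ = 2 * |Real.sin (Real.pi * u)| := by
    have : z ^ N = Complex.exp (Complex.I * ((2 * Real.pi * u : ℝ) : ℂ)) := by
      rw [← Complex.exp_nat_mul]
      congr 1
      have : (N : ℂ) ≠ 0 := by exact_mod_cast hN.ne'
      simp only [θ]
      push_cast
      field_simp
    rw [this, Complex.norm_exp_I_mul_ofReal_sub_one, norm_mul, Real.norm_eq_abs, Real.norm_eq_abs,
      abs_two, show 2 * Real.pi * u / 2 = Real.pi * u by ring]
  have hz1 : ‖z - 1‖ ≤ 2 * Real.pi * |u| / N := by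
    refine (Real.norm_exp_I_mul_ofReal_sub_one_le).trans_eq ?_
    simp only [θ, Real.norm_eq_abs, abs_div, abs_mul, abs_two, abs_of_pos hpi, Nat.abs_cast]
  rw [fourierAmplitude, ← hu, hsum, norm_mul, abs_div, abs_mul, abs_of_pos hpi]
  have hu' : 0 < |u| := abs_pos.mpr hu0
  rw [div_le_iff₀ (by positivity)]
  have h2 : ‖(1 / N : ℂ)‖ = 1 / N := by simp
  rw [h2]
  have h3 := mul_le_mul_of_nonneg_left hz1 (norm_nonneg (∑ x ∈ Finset.range N, z ^ x))
  rw [hmul, hzN] at h3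
  calc |Real.sin (Real.pi * u)| ≤
        (‖∑ x ∈ Finset.range N, z ^ x‖ * (2 * Real.pi * |u| / N)) / 2 := by linarith
    _ = _ := by ring

/-- The two integers nearest to `κ` carry two thirds of the probability. -/
theorem two_thirds_le_fourierAmplitude (N : ℕ) (hN : 0 < N) (κ : ℝ) (hκ : (⌊κ⌋ : ℝ) ≠ κ) :
    2 / 3 ≤ ‖fourierAmplitude N κ ⌊κ⌋‖ ^ 2 + ‖fourierAmplitude N κ (⌊κ⌋ + 1)‖ ^ 2 := by
  set s := Int.fract κ with hs
  have hsκ : κ - ⌊κ⌋ = s := rfl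
  have hs0 : 0 < s := lt_of_le_of_ne (Int.fract_nonneg κ) fun h => hκ (by linarith)
  have hs1 : s < 1 := Int.fract_lt_one κ
  have h1 := sinc_le_norm_fourierAmplitude N hN κ ⌊κ⌋ (Ne.symm hκ)
  have h2 := sinc_le_norm_fourierAmplitude N hN κ (⌊κ⌋ + 1) (by
    intro h; linarith)
  rw [hsκ] at h1
  rw [show κ - (⌊κ⌋ + 1) = -(1 - s) by rw [← hsκ]; ring,
    show Real.pi * -(1 - s) = -(Real.pi * (1 - s)) by ring, Real.sin_neg, neg_div_neg_eq,
    show Real.sin (Real.pi * (1 - s)) = Real.sin (Real.pi * s) by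
      rw [show Real.pi * (1 - s) = Real.pi - Real.pi * s by ring, Real.sin_pi_sub]] at h2
  have h1' := pow_le_pow_left₀ (abs_nonneg _) h1 2
  have h2' := pow_le_pow_left₀ (abs_nonneg _) h2 2
  rw [sq_abs] at h1' h2'
  linarith [two_thirds_le_sinc_sq_add hs0 hs1]

/-- The representative of `k` modulo `N` in `[-N/2, N/2)`. -/
def centeredRep {N : ℕ} (k : Fin N) : ℤ := if 2 * (k : ℕ) < N then (k : ℕ) else (k : ℕ) - (N : ℤ)

theorem exists_centeredRep_eq {N : ℕ} (b : ℤ) (h1 : -(N : ℤ) ≤ 2 * b) (h2 : 2 * b < N) :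
    ∃ k : Fin N, centeredRep k = b := by
  unfold centeredRep
  rcases le_or_gt 0 b with hb | hb
  · refine ⟨⟨b.toNat, by omega⟩, ?_⟩
    simp only
    rw [if_pos (by omega)]
    omega
  · refine ⟨⟨(b + N).toNat, by omega⟩, ?_⟩
    simp only
    rw [if_neg (by omega)]
    omega

theorem fourierAmplitude_centeredRep {N : ℕ} (k : Fin N) (κ : ℝ) :
    fourierAmplitude N κ (centeredRep k) = fourierAmplitude N κ (k : ℕ) := by
  unfold centeredRep
  split_ifs
  · simp
  · push_cast
    exact fourierAmplitude_sub_natCast N (by have := k.isLt; omega) κ _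

open Classical in
/-- Reading the outcome of the Fourier transform as a number in `[-N/2, N/2)` gives `κ` up to an
error of one, except with probability `1/3`. -/
theorem two_thirds_le_sum_fourierAmplitude {N : ℕ} (κ : ℝ) (hκ : |κ| < (N : ℝ) / 2 - 1) :
    2 / 3 ≤ ∑ k : Fin N,
      if |(centeredRep k : ℝ) - κ| ≤ 1 then ‖fourierAmplitude N κ (k : ℕ)‖ ^ 2 else 0 := by
  obtain ⟨hκ1, hκ2⟩ := abs_lt.mp hκ
  have hfl := Int.floor_le κ
  have hfl' := Int.lt_floor_add_one κ
  have hN : (2 : ℝ) < N := by linarith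
  have hN2 : 2 < N := by exact_mod_cast hN
  have b1 : -(N : ℤ) ≤ 2 * ⌊κ⌋ := by
    have : -(N : ℝ) < 2 * (⌊κ⌋ : ℝ) := by linarith
    have : -(N : ℤ) < 2 * ⌊κ⌋ := by exact_mod_cast this
    exact this.le
  have b2 : 2 * (⌊κ⌋ + 1) < (N : ℤ) := by
    have : 2 * ((⌊κ⌋ : ℝ) + 1) < N := by linarith
    exact_mod_cast this
  obtain ⟨k₀, hk₀⟩ := exists_centeredRep_eq (N := N) ⌊κ⌋ b1 (by omega)
  obtain ⟨k₁, hk₁⟩ := exists_centeredRep_eq (N := N) (⌊κ⌋ + 1) (by omega) b2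
  have hne : k₀ ≠ k₁ := by
    rintro rfl
    omega
  set f : Fin N → ℝ := fun k =>
    if |(centeredRep k : ℝ) - κ| ≤ 1 then ‖fourierAmplitude N κ (k : ℕ)‖ ^ 2 else 0 with hf
  have hf0 : ∀ k, 0 ≤ f k := fun k => by
    simp only [hf]
    split_ifs <;> positivity
  have e₀ : f k₀ = ‖fourierAmplitude N κ ⌊κ⌋‖ ^ 2 := by
    simp only [hf]
    rw [← fourierAmplitude_centeredRep, hk₀, if_pos]
    rw [abs_le]
    constructor <;> linarith
  have e₁ : f k₁ = ‖fourierAmplitude N κ (⌊κ⌋ + 1)‖ ^ 2 := by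
    simp only [hf]
    rw [← fourierAmplitude_centeredRep, hk₁, if_pos]
    · push_cast
      rfl
    · rw [abs_le]
      push_cast
      constructor <;> linarith
  have hpair : f k₀ + f k₁ ≤ ∑ k, f k := by
    rw [← Finset.sum_pair hne]
    exact Finset.sum_le_sum_of_subset_of_nonneg (Finset.subset_univ _) fun k _ _ => hf0 k
  rw [e₀, e₁] at hpair
  by_cases hint : (⌊κ⌋ : ℝ) = κ
  · have : fourierAmplitude N κ ⌊κ⌋ = 1 := by
      rw [hint]
      exact fourierAmplitude_self N (by omega) κ
    rw [this, norm_one] at hpair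
    have := sq_nonneg ‖fourierAmplitude N κ (⌊κ⌋ + 1)‖
    linarith
  · exact (two_thirds_le_fourierAmplitude N (by omega) κ hint).trans hpair

/-! ### Phase estimation on several registers -/

section ProductGate

variable {d N : ℕ}

/-- The gate that acts with `U` on each of `d` registers. -/
noncomputable def productGate (d : ℕ) (U : Matrix.unitaryGroup (Fin N) ℂ) :
    Matrix.unitaryGroup (Fin d → Fin N) ℂ :=
  ⟨Matrix.of fun k x => ∏ i, (U : Matrix (Fin N) (Fin N) ℂ) (k i) (x i), by
    rw [Matrix.mem_unitaryGroup_iff]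
    ext k k'
    have hU : ∀ a b, ∑ x, (U : Matrix (Fin N) (Fin N) ℂ) a x *
        star ((U : Matrix (Fin N) (Fin N) ℂ) b x) = if a = b then 1 else 0 := by
      intro a b
      have := congrFun (congrFun (Matrix.mem_unitaryGroup_iff.mp U.2) a) b
      rwa [Matrix.mul_apply, Matrix.one_apply] at this
    rw [Matrix.mul_apply]
    simp only [Matrix.star_apply, Matrix.of_apply, star_prod, ← Finset.prod_mul_distrib]
    rw [← Fintype.prod_sum fun i x => (U : Matrix (Fin N) (Fin N) ℂ) (k i) x *
        star ((U : Matrix (Fin N) (Fin N) ℂ) (k' i) x)]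
    simp only [hU, Matrix.one_apply, Finset.prod_ite_zero, Finset.mem_univ, true_imp_iff,
      Finset.prod_const_one, funext_iff]⟩

theorem productGate_mulVec (U : Matrix.unitaryGroup (Fin N) ℂ) (f : Fin d → Fin N → ℂ)
    (k : Fin d → Fin N) :
    ((productGate d U).1 *ᵥ fun x => ∏ i, f i (x i)) k = ∏ i, (U.1 *ᵥ f i) (k i) := by
  simp only [productGate, Matrix.mulVec, dotProduct, Matrix.of_apply, ← Finset.prod_mul_distrib]
  rw [← Fintype.prod_sum fun i x => U.1 (k i) x * f i x]

open Classical in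
/-- The marginal of a product distribution. -/
theorem sum_ite_prod (a : Fin d → Fin N → ℝ) (ha : ∀ i, ∑ x, a i x = 1) (i : Fin d)
    (b : Fin N → Prop) :
    (∑ k : Fin d → Fin N, if b (k i) then ∏ i', a i' (k i') else 0) =
      ∑ x, if b x then a i x else 0 := by
  let F : Fin d → Fin N → ℝ := fun i' x => a i' x * if i' = i then (if b x then 1 else 0) else 1
  have hF : ∀ k : Fin d → Fin N,
      (if b (k i) then ∏ i', a i' (k i') else 0) = ∏ i', F i' (k i') := by
    intro k
    simp only [F, Finset.prod_mul_distrib, Finset.prod_ite_eq', Finset.mem_univ, if_true]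
    split_ifs <;> simp
  simp only [hF]
  rw [← Fintype.prod_sum, Finset.prod_eq_single i]
  · simp [F]
  · intro i' _ hi'
    simp [F, hi', ha]
  · simp

end ProductGate

section Fourier

variable {N : ℕ}

/-- Orthogonality of the characters of `ℤ/N`. -/
theorem fourierAmplitude_natCast (k k' : Fin N) :
    fourierAmplitude N (k' : ℕ) (k : ℕ) = if k = k' then 1 else 0 := by
  have hN : 0 < N := by have := k.isLt; omega
  split_ifs with h
  · subst h
    exact fourierAmplitude_self N hN _
  · have hNC : (N : ℂ) ≠ 0 := by exact_mod_cast hN.ne'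
    let z : ℂ := Complex.exp (2 * Real.pi * Complex.I * (((k' : ℤ) - (k : ℤ) : ℤ) : ℂ) / N)
    have hz : z ≠ 1 := by
      intro hz
      obtain ⟨m, hm⟩ := Complex.exp_eq_one_iff.mp hz
      have h2 : (((k' : ℤ) - (k : ℤ) : ℤ) : ℂ) = ((m * N : ℤ) : ℂ) := by
        have hpi : (2 * Real.pi * Complex.I : ℂ) ≠ 0 := Complex.two_pi_I_ne_zero
        rw [div_eq_iff hNC] at hm
        apply mul_left_cancel₀ hpi
        rw [hm]
        push_cast
        ring
      have h3 : ((k' : ℤ) - (k : ℤ) : ℤ) = m * N := by exact_mod_cast h2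
      have hk := k.isLt
      have hk' := k'.isLt
      have hm0 : m = 0 := by
        have l1 : m * N < 1 * N := by omega
        have l2 : (-1) * (N : ℤ) < m * N := by omega
        have := lt_of_mul_lt_mul_right l1 (by omega)
        have := lt_of_mul_lt_mul_right l2 (by omega)
        omega
      rw [hm0, zero_mul] at h3
      exact h (Fin.ext (by omega))
    have hzN : z ^ N = 1 := by
      rw [← Complex.exp_nat_mul, mul_div_cancel₀ _ hNC, mul_comm]
      exact Complex.exp_int_mul_two_pi_mul_I _
    have hsum : ∑ x : Fin N, Complex.exp
        (Complex.I * (2 * Real.pi * ((k' : ℕ) - (k : ℕ)) * (x : ℕ) / N : ℝ)) =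
        ∑ x ∈ Finset.range N, z ^ x := by
      rw [Finset.sum_range]
      refine Finset.sum_congr rfl fun x _ => ?_
      rw [← Complex.exp_nat_mul]
      congr 1
      push_cast
      ring
    have h0 : (∑ x ∈ Finset.range N, z ^ x) * (z - 1) = 0 := by
      rw [geom_sum_mul, hzN, sub_self]
    rw [fourierAmplitude, hsum, (mul_eq_zero.mp h0).resolve_right (sub_ne_zero.mpr hz), mul_zero]

/-- The inverse Fourier transform on `ℤ/N`. -/
noncomputable def fourierGate (N : ℕ) : Matrix.unitaryGroup (Fin N) ℂ :=
  ⟨Matrix.of fun k x => (1 / (Real.sqrt N : ℂ)) *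
      Complex.exp (-(Complex.I * (2 * Real.pi * (k : ℕ) * (x : ℕ) / N : ℝ))), by
    rw [Matrix.mem_unitaryGroup_iff]
    ext k k'
    rw [Matrix.one_apply, ← fourierAmplitude_natCast, fourierAmplitude, Matrix.mul_apply,
      Finset.mul_sum]
    refine Finset.sum_congr rfl fun x _ => ?_
    have hN : ((Real.sqrt N : ℂ)) * (Real.sqrt N : ℂ) = N := by
      rw [← Complex.ofReal_mul, Real.mul_self_sqrt (Nat.cast_nonneg N)]
      simp
    rw [Matrix.star_apply, Matrix.of_apply, Matrix.of_apply, star_mul', Complex.star_def,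
      ← Complex.exp_conj, mul_mul_mul_comm, ← Complex.exp_add]
    congr 1
    · simp only [one_div, map_inv₀, Complex.conj_ofReal]
      rw [← mul_inv, hN]
    · congr 1
      simp only [map_neg, map_mul, Complex.conj_I, Complex.conj_ofReal]
      push_cast
      ring⟩

/-- The uniform superposition with phases `e^{2πiκx/N}`. -/
noncomputable def planeWave (N : ℕ) (κ : ℝ) : Fin N → ℂ := fun x =>
  (1 / (Real.sqrt N : ℂ)) * Complex.exp (Complex.I * (2 * Real.pi * κ * (x : ℕ) / N : ℝ))

theorem fourierGate_mulVec_planeWave (κ : ℝ) (k : Fin N) :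
    ((fourierGate N).1 *ᵥ planeWave N κ) k = fourierAmplitude N κ (k : ℕ) := by
  change ∑ x, (fourierGate N).1 k x * planeWave N κ x = _
  rw [fourierAmplitude, Finset.mul_sum]
  refine Finset.sum_congr rfl fun x _ => ?_
  have hN : ((Real.sqrt N : ℂ)) * (Real.sqrt N : ℂ) = N := by
    rw [← Complex.ofReal_mul, Real.mul_self_sqrt (Nat.cast_nonneg N)]
    simp
  simp only [fourierGate, planeWave, Matrix.of_apply]
  rw [mul_mul_mul_comm, ← Complex.exp_add]
  congr 1
  · rw [one_div, ← mul_inv, hN, one_div]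
  · congr 1
    push_cast
    ring

theorem norm_planeWave_sq (κ : ℝ) (x : Fin N) : ‖planeWave N κ x‖ ^ 2 = 1 / N := by
  rw [planeWave, norm_mul, mul_comm Complex.I, Complex.norm_exp_ofReal_mul_I, mul_one, norm_div,
    norm_one, Complex.norm_real, Real.norm_of_nonneg (Real.sqrt_nonneg _), div_pow,
    Real.sq_sqrt (Nat.cast_nonneg N), one_pow]

theorem sum_norm_fourierAmplitude_sq (hN : 0 < N) (κ : ℝ) :
    ∑ k : Fin N, ‖fourierAmplitude N κ (k : ℕ)‖ ^ 2 = 1 := by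
  simp only [← fourierGate_mulVec_planeWave]
  rw [sum_norm_sq_unitary_mulVec]
  have : (N : ℝ) ≠ 0 := by exact_mod_cast hN.ne'
  simp [norm_planeWave_sq, this]

theorem norm_add_sq_le_weighted (u v : ℂ) : ‖u + v‖ ^ 2 ≤ 6 / 5 * ‖u‖ ^ 2 + 6 * ‖v‖ ^ 2 := by
  have h := pow_le_pow_left₀ (norm_nonneg _) (norm_add_le u v) 2
  nlinarith [sq_nonneg (‖u‖ - 5 * ‖v‖)]

theorem liftGate_mulVec_apply {X W : Type} [Fintype X] [DecidableEq X] [Fintype W] [DecidableEq W]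
    (U : Matrix.unitaryGroup X ℂ) (ψ : X × W → ℂ) (x : X) (w : W) :
    ((liftGate W U).1 *ᵥ ψ) (x, w) = (U.1 *ᵥ fun x' => ψ (x', w)) x := by
  simp [liftGate, Matrix.mulVec, dotProduct, Fintype.sum_prod_type, Matrix.one_apply]

variable {d : ℕ} {W : Type} [Fintype W] [DecidableEq W]

open Classical in
/-- Phase estimation, stable under perturbations: if the state `ψ` is close to a superposition of
product plane waves with the frequencies `κ w i`, then the `i`-th register of the Fourier transform
shows `κ w i` up to an error of one with probability bounded below. -/
theorem sum_bad_fourier_le (hN : 0 < N) (κ : W → Fin d → ℝ)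
    (hκ : ∀ w i, |κ w i| < (N : ℝ) / 2 - 1) (g : W → ℂ) (hg : ∑ w, ‖g w‖ ^ 2 = 1)
    (ψ : (Fin d → Fin N) × W → ℂ) (η : ℝ)
    (hψ : ∑ p, ‖ψ p - g p.2 * ∏ i, planeWave N (κ p.2 i) (p.1 i)‖ ^ 2 ≤ η) (i : Fin d) :
    (∑ p, if ¬ |(centeredRep (p.1 i) : ℝ) - κ p.2 i| ≤ 1 then
      ‖((liftGate W (productGate d (fourierGate N))).1 *ᵥ ψ) p‖ ^ 2 else 0) ≤ 2 / 5 + 6 * η := by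
  let V := liftGate W (productGate d (fourierGate N))
  let ψ₀ : (Fin d → Fin N) × W → ℂ := fun p => g p.2 * ∏ i, planeWave N (κ p.2 i) (p.1 i)
  have hV₀ : ∀ p, (V.1 *ᵥ ψ₀) p = g p.2 * ∏ i, fourierAmplitude N (κ p.2 i) (p.1 i : ℕ) := by
    rintro ⟨k, w⟩
    have h1 : (fun x => ψ₀ (x, w)) = g w • fun x => ∏ i, planeWave N (κ w i) (x i) := rfl
    rw [liftGate_mulVec_apply, h1, Matrix.mulVec_smul, Pi.smul_apply, productGate_mulVec]
    simp only [fourierGate_mulVec_planeWave, smul_eq_mul]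
  have hbad₀ : (∑ p, if ¬ |(centeredRep (p.1 i) : ℝ) - κ p.2 i| ≤ 1 then
      ‖(V.1 *ᵥ ψ₀) p‖ ^ 2 else 0) ≤ 1 / 3 := by
    rw [Fintype.sum_prod_type_right]
    calc _ ≤ ∑ w, ‖g w‖ ^ 2 * (1 / 3) := by
          refine Finset.sum_le_sum fun w _ => ?_
          have h1 := sum_ite_prod (d := d)
            (fun i k => ‖fourierAmplitude N (κ w i) ((k : Fin N) : ℕ)‖ ^ 2)
            (fun i => sum_norm_fourierAmplitude_sq hN _) i
            (fun k => ¬ |(centeredRep k : ℝ) - κ w i| ≤ 1)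
          have h2 : (∑ k : Fin N, if ¬ |(centeredRep k : ℝ) - κ w i| ≤ 1 then
              ‖fourierAmplitude N (κ w i) (k : ℕ)‖ ^ 2 else 0) ≤ 1 / 3 := by
            have h3 := two_thirds_le_sum_fourierAmplitude (κ w i) (hκ w i)
            have h4 := sum_norm_fourierAmplitude_sq hN (κ w i)
            have h5 : ∀ k : Fin N, ‖fourierAmplitude N (κ w i) (k : ℕ)‖ ^ 2 =
                (if |(centeredRep k : ℝ) - κ w i| ≤ 1 then
                  ‖fourierAmplitude N (κ w i) (k : ℕ)‖ ^ 2 else 0) +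
                if ¬ |(centeredRep k : ℝ) - κ w i| ≤ 1 then
                  ‖fourierAmplitude N (κ w i) (k : ℕ)‖ ^ 2 else 0 := by
              intro k
              split_ifs <;> simp
            rw [Finset.sum_congr rfl fun k _ => h5 k, Finset.sum_add_distrib] at h4
            linarith
          replace h2 := h1.trans_le (by convert h2)
          refine le_trans (le_of_eq ?_) (mul_le_mul_of_nonneg_left h2 (sq_nonneg ‖g w‖))
          rw [Finset.mul_sum]
          refine Finset.sum_congr rfl fun k _ => ?_
          rw [hV₀, norm_mul, mul_pow, norm_prod, ← Finset.prod_pow]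
          split_ifs <;> simp
      _ = 1 / 3 := by rw [← Finset.sum_mul, hg, one_mul]
  have hdiff : ∑ p, ‖(V.1 *ᵥ (ψ - ψ₀)) p‖ ^ 2 ≤ η := by
    rw [sum_norm_sq_unitary_mulVec]
    exact hψ
  calc _ ≤ ∑ p, (6 / 5 * (if ¬ |(centeredRep (p.1 i) : ℝ) - κ p.2 i| ≤ 1 then
            ‖(V.1 *ᵥ ψ₀) p‖ ^ 2 else 0) + 6 * ‖(V.1 *ᵥ (ψ - ψ₀)) p‖ ^ 2) := by
        refine Finset.sum_le_sum fun p _ => ?_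
        have h1 : (V.1 *ᵥ ψ) p = (V.1 *ᵥ ψ₀) p + (V.1 *ᵥ (ψ - ψ₀)) p := by
          rw [← Pi.add_apply, ← Matrix.mulVec_add, add_sub_cancel]
        have h2 := norm_add_sq_le_weighted ((V.1 *ᵥ ψ₀) p) ((V.1 *ᵥ (ψ - ψ₀)) p)
        rw [← h1] at h2
        split_ifs
        · positivity
        · exact h2
    _ ≤ 2 / 5 + 6 * η := by
        rw [Finset.sum_add_distrib, ← Finset.mul_sum, ← Finset.mul_sum]
        linarith

end Fourier

/-! ### Queries at the two ends of an edge of the cube -/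

section Queries

theorem sum_indicator_le_of_almostAll {X : Type} [Fintype X] {P : X → Prop} [DecidablePred P] (hP : AlmostAll P) :
    (∑ x, if P x then (0 : ℝ) else 1) ≤ 1 / 1000 * Fintype.card X := by
  refine le_trans (le_of_eq ?_) hP
  rw [Finset.sum_ite, Finset.sum_const_zero, zero_add, Finset.sum_const, nsmul_one,
    Set.ncard_eq_toFinset_card', Set.toFinset_ofPred]

/-- A property of almost all points holds jointly at the images of some point under four
permutations. -/
theorem exists_forall_of_almostAll {X : Type} [Fintype X] [Nonempty X] {P : X → Prop} (hP : AlmostAll P)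
    (e : Fin 4 → Equiv.Perm X) : ∃ x, ∀ a, P (e a x) := by
  classical
  by_contra! hcon
  have h1 : (Fintype.card X : ℝ) ≤ ∑ x, ∑ a, if P (e a x) then (0 : ℝ) else 1 := by
    rw [← Finset.card_univ, ← nsmul_one, ← Finset.sum_const]
    refine Finset.sum_le_sum fun x _ => ?_
    obtain ⟨a, ha⟩ := hcon x
    have := Finset.single_le_sum (f := fun a => if P (e a x) then (0 : ℝ) else 1)
      (fun a _ => by split_ifs <;> norm_num) (Finset.mem_univ a)
    simpa [ha] using this
  rw [Finset.sum_comm] at h1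
  have h2 : ∀ a, (∑ x, if P (e a x) then (0 : ℝ) else 1) ≤ 1 / 1000 * Fintype.card X := fun a => by
    rw [Equiv.sum_comp (e a) fun x => if P x then (0 : ℝ) else 1]
    exact sum_indicator_le_of_almostAll hP
  have h3 := Finset.sum_le_sum fun a (_ : a ∈ Finset.univ) => h2 a
  have hc : (0 : ℝ) < Fintype.card X := by exact_mod_cast Fintype.card_pos
  simp only [Finset.sum_const, Finset.card_univ, Fintype.card_fin, nsmul_eq_mul] at h3
  push_cast at h3
  linarith

variable {X : Type} [Fintype X] [DecidableEq X]

theorem runState_append (φ : X → ℝ) (L L' : List (Step X)) (ψ : X → ℂ) :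
    runState φ (L ++ L') ψ = runState φ L' (runState φ L ψ) :=
  List.foldl_append

theorem runState_replicate_query (φ : X → ℝ) (q : ℕ) (ψ : X → ℂ) :
    runState φ (List.replicate q .query) ψ =
      fun x => Complex.exp (Complex.I * (q * φ x : ℝ)) * ψ x := by
  induction q generalizing ψ with
  | zero => simp [runState]
  | succ q ih =>
    rw [List.replicate_succ, ← List.singleton_append, runState_append, ih]
    funext x
    simp only [runState, List.foldl_cons, List.foldl_nil, Step.apply, queryOracle,
      Matrix.mulVec_diagonal]
    rw [← mul_assoc, ← Complex.exp_add]
    congr 2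
    push_cast
    ring

theorem runState_replicate_queryInv (φ : X → ℝ) (q : ℕ) (ψ : X → ℂ) :
    runState φ (List.replicate q .queryInv) ψ =
      fun x => Complex.exp (-(Complex.I * (q * φ x : ℝ))) * ψ x := by
  induction q generalizing ψ with
  | zero => simp [runState]
  | succ q ih =>
    rw [List.replicate_succ, ← List.singleton_append, runState_append, ih]
    funext x
    simp only [runState, List.foldl_cons, List.foldl_nil, Step.apply, queryOracle,
      Matrix.diagonal_conjTranspose, Matrix.mulVec_diagonal, Pi.star_apply, Complex.star_def,
      ← Complex.exp_conj]
    rw [← mul_assoc, ← Complex.exp_add]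
    congr 2
    simp only [map_mul, Complex.conj_I, Complex.conj_ofReal]
    push_cast
    ring

end Queries

section Differences

variable {d n : ℕ}

/-- The permutation of the labels that moves the sample point along the `j`-th edge of the cube. -/
def flipBit (j : Fin d) : Equiv.Perm (Label d n) where
  toFun l := (l.1, Function.update l.2 j (!l.2 j))
  invFun l := (l.1, Function.update l.2 j (!l.2 j))
  left_inv l := by simp
  right_inv l := by simp

/-- The sign of the `j`-th coordinate of `y - y'`, where `y'` is `y` with the bit `b` flipped. -/
def bitSign (b : Bool) : ℝ := if b then 1 else -1

theorem bitSign_mul_self (b : Bool) : bitSign b * bitSign b = 1 := by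
  cases b <;> simp [bitSign]

/-- The value at the sample points of the quadratic form of `H`. -/
noncomputable def quadraticValue (H : Matrix (Fin d) (Fin d) ℝ) (l : Label d n) : ℝ :=
  samplePoint l ⬝ᵥ (H *ᵥ samplePoint l)

theorem samplePoint_eq_flipBit_add (l : Label d n) (j : Fin d) :
    samplePoint l = samplePoint (flipBit j l) + bitSign (l.2 j) • Pi.single j 1 := by
  funext i
  by_cases hij : i = j
  · subst hij
    cases h : l.2 i <;> simp [samplePoint, flipBit, cubePoint, bitSign, h]
  · simp [samplePoint, flipBit, cubePoint, hij]

/-- The part of `quadraticValue H l - quadraticValue H (flipBit j l)` that does not depend on the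
grid point, up to the sign `bitSign (l.2 j)`. -/
noncomputable def flipOffset (n : ℕ) (H : Matrix (Fin d) (Fin d) ℝ) (j : Fin d) (b : Fin d → Bool) : ℝ :=
  2 * ∑ i, H i j * (1 / 2 ^ (n + 1) - 1 / 2 + cubePoint (Function.update b j (!b j)) i) +
    bitSign (b j) * H j j

theorem quadraticValue_sub_flipBit {H : Matrix (Fin d) (Fin d) ℝ} (hH : H.IsSymm)
    (l : Label d n) (j : Fin d) :
    quadraticValue H l - quadraticValue H (flipBit j l) =
      bitSign (l.2 j) * (2 * ∑ i, H i j * (((l.1 i : ℕ) : ℝ) / 2 ^ n) +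
        flipOffset n H j l.2) := by
  have hcol : (H *ᵥ samplePoint (flipBit j l)) j = ∑ i, H i j * samplePoint (flipBit j l) i := by
    change ∑ i, H j i * samplePoint (flipBit j l) i = _
    exact Finset.sum_congr rfl fun i _ => by rw [hH.apply]
  have hcol' : samplePoint (flipBit j l) ⬝ᵥ H.col j =
      ∑ i, H i j * samplePoint (flipBit j l) i :=
    Finset.sum_congr rfl fun i _ => by rw [Matrix.col_apply, mul_comm]
  have hw : ∀ i, samplePoint (flipBit j l) i = ((l.1 i : ℕ) : ℝ) / 2 ^ n +
      (1 / 2 ^ (n + 1) - 1 / 2 + cubePoint (Function.update l.2 j (!l.2 j)) i) := by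
    intro i
    simp only [samplePoint, flipBit, gridPoint, Pi.add_apply, Equiv.coe_fn_mk]
    field_simp
    ring
  have hsum : ∑ i, H i j * samplePoint (flipBit j l) i =
      ∑ i, H i j * (((l.1 i : ℕ) : ℝ) / 2 ^ n) + ∑ i, H i j *
        (1 / 2 ^ (n + 1) - 1 / 2 + cubePoint (Function.update l.2 j (!l.2 j)) i) := by
    rw [← Finset.sum_add_distrib]
    exact Finset.sum_congr rfl fun i _ => by rw [hw, mul_add]
  unfold quadraticValue
  rw [samplePoint_eq_flipBit_add l j]
  simp only [Matrix.mulVec_add, add_dotProduct, dotProduct_add, Matrix.mulVec_smul,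
    smul_dotProduct, dotProduct_smul, Matrix.mulVec_single_one, single_dotProduct, one_mul,
    smul_eq_mul, hcol, hcol', flipOffset, Matrix.col_apply]
  linear_combination 2 * bitSign (l.2 j) * hsum

end Differences

section Run

variable {d n : ℕ}

/-- One run for the column `j`: from the uniform superposition prepared by `U`, `q` queries at each
of the two ends of the `j`-th edge of the cube, and the inverse Fourier transform of the grid
register. -/
noncomputable def columnRun (q : ℕ) (j : Fin d) (U : Matrix.unitaryGroup (Label d n) ℂ) :
    List (Step (Label d n)) :=
  [.gate U] ++ (List.replicate q .queryInv ++ ([.gate (permGate (flipBit j))] ++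
    (List.replicate q .query ++
      [.gate (liftGate (Fin d → Bool) (productGate d (fourierGate (2 ^ n))))])))

theorem cost_columnRun (q : ℕ) (j : Fin d) (U : Matrix.unitaryGroup (Label d n) ℂ) :
    ((columnRun q j U).map Step.cost).sum = 2 * q := by
  simp [columnRun, Step.cost, two_mul]

/-- The amplitude of the uniform superposition of all labels. -/
noncomputable def uniformAmplitude (d n : ℕ) : ℂ :=
  (1 / (Real.sqrt (2 : ℝ) : ℂ)) ^ d * (1 / (Real.sqrt ((2 ^ n : ℕ) : ℝ) : ℂ)) ^ d

theorem norm_one_div_sqrt_pow_sq {x : ℝ} (hx : 0 ≤ x) (d : ℕ) :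
    ‖(1 / (Real.sqrt x : ℂ)) ^ d‖ ^ 2 = (1 / x) ^ d := by
  rw [norm_pow, ← pow_mul, mul_comm d 2, pow_mul, norm_div, norm_one, Complex.norm_real,
    Real.norm_of_nonneg (Real.sqrt_nonneg _), div_pow, Real.sq_sqrt hx, one_pow]

theorem norm_uniformAmplitude_sq (d n : ℕ) :
    ‖uniformAmplitude d n‖ ^ 2 = 1 / Fintype.card (Label d n) := by
  rw [uniformAmplitude, norm_mul, mul_pow, norm_one_div_sqrt_pow_sq (by norm_num),
    norm_one_div_sqrt_pow_sq (Nat.cast_nonneg _)]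
  simp [mul_comm]

theorem runState_columnRun (φ : Label d n → ℝ) (q : ℕ) (j : Fin d)
    (U : Matrix.unitaryGroup (Label d n) ℂ) (l₀ : Label d n)
    (hU : U.1 *ᵥ Pi.single l₀ 1 = fun _ => uniformAmplitude d n) :
    runState φ (columnRun q j U) (Pi.single l₀ 1) =
      (liftGate (Fin d → Bool) (productGate d (fourierGate (2 ^ n)))).1 *ᵥ
        fun l => Complex.exp (Complex.I * (q * (φ l - φ (flipBit j l)) : ℝ)) *
          uniformAmplitude d n := by
  have hgate : ∀ (V : Matrix.unitaryGroup (Label d n) ℂ) (ψ : Label d n → ℂ),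
      runState φ [.gate V] ψ = V.1 *ᵥ ψ := fun _ _ => rfl
  have hperm : ∀ ψ : Label d n → ℂ, (permGate (flipBit j)).1 *ᵥ ψ = ψ ∘ flipBit j :=
    fun ψ => Matrix.permMatrix_mulVec _
  rw [columnRun, runState_append, runState_append, runState_append, runState_append, hgate U, hU,
    runState_replicate_queryInv, hgate (permGate _), hperm, runState_replicate_query, hgate]
  congr 1
  funext l
  simp only [Function.comp_apply]
  rw [← mul_assoc, ← Complex.exp_add]
  congr 2
  push_cast
  ring

open Classical in
/-- Single-run guarantee: for each row `i`, the run for the column `j` shows `H i j` up to `π / q`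
except with probability `47/100`. -/
theorem sum_bad_columnRun_le {H : Matrix (Fin d) (Fin d) ℝ} (hH : H.IsSymm) (c δ : ℝ)
    (φ : Label d n → ℝ) (hφ : AlmostAll fun l => |φ l - quadraticValue H l - c| ≤ δ)
    (q : ℕ) (hq : 0 < q) (hδ : 2 * q * δ ≤ 1 / 20)
    (hN : ∀ i j, q * |H i j| / Real.pi < ((2 ^ n : ℕ) : ℝ) / 2 - 1)
    (U : Matrix.unitaryGroup (Label d n) ℂ) (l₀ : Label d n)
    (hU : U.1 *ᵥ Pi.single l₀ 1 = fun _ => uniformAmplitude d n) (i j : Fin d) :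
    (∑ l : Label d n,
      if ¬ |bitSign (l.2 j) * (centeredRep (l.1 i) : ℝ) * Real.pi / q - H i j| ≤ Real.pi / q then
        ‖runState φ (columnRun q j U) (Pi.single l₀ 1) l‖ ^ 2 else 0) ≤ 47 / 100 := by
  have hpi := Real.pi_pos
  have hq' : (0 : ℝ) < q := by exact_mod_cast hq
  have hN0 : 0 < 2 ^ n := by positivity
  let κ : (Fin d → Bool) → Fin d → ℝ := fun b i => bitSign (b j) * (q * H i j / Real.pi)
  have habs : ∀ b, |bitSign b| = 1 := fun b => by cases b <;> simp [bitSign]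
  have hκ : ∀ b i, |κ b i| < ((2 ^ n : ℕ) : ℝ) / 2 - 1 := by
    intro b i
    simp only [κ]
    rw [abs_mul, habs, one_mul, abs_div, abs_mul, abs_of_pos hpi, abs_of_pos hq']
    exact hN i j
  let g : (Fin d → Bool) → ℂ := fun b =>
    Complex.exp (Complex.I * (q * (bitSign (b j) * flipOffset n H j b) : ℝ)) *
      (1 / (Real.sqrt (2 : ℝ) : ℂ)) ^ d
  have hg : ∑ b, ‖g b‖ ^ 2 = 1 := by
    have : ∀ b, ‖g b‖ ^ 2 = (1 / 2) ^ d := by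
      intro b
      rw [norm_mul, mul_comm Complex.I, Complex.norm_exp_ofReal_mul_I, one_mul,
        norm_one_div_sqrt_pow_sq (by norm_num)]
    simp [this]
  -- The state for the exact quadratic form is a superposition of products of plane waves.
  have hideal : ∀ l : Label d n, g l.2 * ∏ i, planeWave (2 ^ n) (κ l.2 i) (l.1 i) =
      Complex.exp (Complex.I *
        (q * (quadraticValue H l - quadraticValue H (flipBit j l)) : ℝ)) *
        uniformAmplitude d n := by
    intro l
    have hph : (q * (quadraticValue H l - quadraticValue H (flipBit j l)) : ℝ) =
        q * (bitSign (l.2 j) * flipOffset n H j l.2) +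
          ∑ i, 2 * Real.pi * κ l.2 i * (l.1 i : ℕ) / (2 ^ n : ℕ) := by
      have hterm : ∀ i, 2 * Real.pi * κ l.2 i * (l.1 i : ℕ) / (2 ^ n : ℕ) =
          q * bitSign (l.2 j) * (2 * (H i j * (((l.1 i : ℕ) : ℝ) / 2 ^ n))) := by
        intro i
        simp only [κ]
        push_cast
        field_simp
      simp only [hterm]
      rw [quadraticValue_sub_flipBit hH, ← Finset.mul_sum, ← Finset.mul_sum]
      ring
    rw [hph]
    simp only [g, planeWave, Finset.prod_mul_distrib, Finset.prod_const, Finset.card_univ,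
      Fintype.card_fin, uniformAmplitude]
    rw [← Complex.exp_sum, ← Finset.mul_sum, Complex.ofReal_add, mul_add, Complex.exp_add,
      Complex.ofReal_sum]
    ring
  let ψ : Label d n → ℂ := fun l =>
    Complex.exp (Complex.I * (q * (φ l - φ (flipBit j l)) : ℝ)) * uniformAmplitude d n
  let P : Label d n → Prop := fun l => |φ l - quadraticValue H l - c| ≤ δ
  have hP : AlmostAll P := hφ
  have hcard : (0 : ℝ) < Fintype.card (Label d n) := by exact_mod_cast Fintype.card_pos
  have hclose : ∑ l, ‖ψ l - g l.2 * ∏ i, planeWave (2 ^ n) (κ l.2 i) (l.1 i)‖ ^ 2 ≤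
      (1 / 20) ^ 2 + 8 / 1000 := by
    have hpt : ∀ l, ‖ψ l - g l.2 * ∏ i, planeWave (2 ^ n) (κ l.2 i) (l.1 i)‖ ^ 2 ≤
        (1 / Fintype.card (Label d n)) * ((1 / 20) ^ 2 + 4 * (if P l then 0 else 1) +
          4 * if P (flipBit j l) then 0 else 1) := by
      intro l
      rw [hideal]
      simp only [ψ]
      rw [← sub_mul, norm_mul, mul_pow, norm_uniformAmplitude_sq, mul_comm]
      refine mul_le_mul_of_nonneg_left ?_ (by positivity)
      set α : ℝ := q * (φ l - φ (flipBit j l)) with hα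
      set β : ℝ := q * (quadraticValue H l - quadraticValue H (flipBit j l)) with hβ
      have hfac : ‖Complex.exp (Complex.I * (α : ℂ)) - Complex.exp (Complex.I * (β : ℂ))‖ =
          ‖Complex.exp (Complex.I * ((α - β : ℝ) : ℂ)) - 1‖ := by
        have : Complex.exp (Complex.I * (α : ℂ)) - Complex.exp (Complex.I * (β : ℂ)) =
            Complex.exp ((β : ℂ) * Complex.I) *
              (Complex.exp (Complex.I * ((α - β : ℝ) : ℂ)) - 1) := by
          rw [mul_sub, ← Complex.exp_add, mul_one, mul_comm (β : ℂ)]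
          congr 2
          push_cast
          ring
        rw [this, norm_mul, Complex.norm_exp_ofReal_mul_I, one_mul]
      have htriv : ‖Complex.exp (Complex.I * (α : ℂ)) - Complex.exp (Complex.I * (β : ℂ))‖ ^ 2 ≤
          4 := by
        rw [hfac, Complex.norm_exp_I_mul_ofReal_sub_one, Real.norm_eq_abs, sq_abs]
        nlinarith [Real.sin_sq_le_one ((α - β) / 2)]
      by_cases h1 : P l
      · by_cases h2 : P (flipBit j l)
        · have h3 : |α - β| ≤ 1 / 20 := by
            have e : α - β = q * ((φ l - quadraticValue H l - c) -
                (φ (flipBit j l) - quadraticValue H (flipBit j l) - c)) := by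
              rw [hα, hβ]
              ring
            rw [e, abs_mul, abs_of_pos hq']
            have := abs_sub (φ l - quadraticValue H l - c)
              (φ (flipBit j l) - quadraticValue H (flipBit j l) - c)
            calc _ ≤ (q : ℝ) * (δ + δ) :=
                  mul_le_mul_of_nonneg_left (this.trans (add_le_add h1 h2)) hq'.le
              _ ≤ _ := by linarith
          have h4 := (Real.norm_exp_I_mul_ofReal_sub_one_le (x := α - β)).trans h3
          rw [← hfac] at h4
          have h5 := pow_le_pow_left₀ (norm_nonneg _) h4 2
          simpa [h1, h2] using h5
        · rw [if_neg h2, if_pos h1]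
          linarith
      · rw [if_neg h1]
        have : (0 : ℝ) ≤ if P (flipBit j l) then 0 else 1 := by split_ifs <;> norm_num
        linarith
    refine (Finset.sum_le_sum fun l _ => hpt l).trans ?_
    rw [← Finset.mul_sum, Finset.sum_add_distrib, Finset.sum_add_distrib, ← Finset.mul_sum,
      ← Finset.mul_sum, Equiv.sum_comp (flipBit j) fun l => if P l then (0 : ℝ) else 1,
      Finset.sum_const, Finset.card_univ, nsmul_eq_mul, one_div, inv_mul_le_iff₀ hcard]
    have := sum_indicator_le_of_almostAll hP
    linarith
  have hmain := sum_bad_fourier_le hN0 κ hκ g hg ψ _ hclose i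
  rw [runState_columnRun φ q j U l₀ hU]
  refine le_trans (Finset.sum_le_sum fun l _ => ?_) (hmain.trans (by norm_num))
  -- Dividing by `q / π` turns an error of one in the frequency into an error of `π / q`.
  have hest : bitSign (l.2 j) * (centeredRep (l.1 i) : ℝ) * Real.pi / q - H i j =
      bitSign (l.2 j) * (Real.pi / q) * ((centeredRep (l.1 i) : ℝ) - κ l.2 i) := by
    have hs := bitSign_mul_self (l.2 j)
    simp only [κ]
    have : bitSign (l.2 j) * (Real.pi / q) *
        (bitSign (l.2 j) * (q * H i j / Real.pi)) = H i j := by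
      calc _ = (bitSign (l.2 j) * bitSign (l.2 j)) * ((Real.pi / q) * (q * H i j / Real.pi)) := by
            ring
        _ = H i j := by
            rw [hs]
            field_simp
    rw [mul_sub, this]
    ring
  have hiff : |bitSign (l.2 j) * (centeredRep (l.1 i) : ℝ) * Real.pi / q - H i j| ≤ Real.pi / q ↔
      |(centeredRep (l.1 i) : ℝ) - κ l.2 i| ≤ 1 := by
    rw [hest, abs_mul, abs_mul, habs, one_mul, abs_of_pos (by positivity : 0 < Real.pi / q)]
    exact mul_le_iff_le_one_right (by positivity)
  simp only [hiff]
  exact le_rfl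

end Run

/-! ### Guessing without queries, and the final algorithm -/

section Guess

variable {X R : Type} [Fintype X] [DecidableEq X]

/-- The algorithm that makes no query and always outputs `r`. -/
def constantAlgorithm (x₀ : X) (r : R) : QueryAlgorithm X R where
  Work := Unit
  init := (x₀, ())
  steps := []
  output _ := r

theorem queries_constantAlgorithm (x₀ : X) (r : R) : (constantAlgorithm x₀ r).queries = 0 := rfl

open Classical in
theorem prob_constantAlgorithm (x₀ : X) {r : R} (φ : X → ℝ) {S : Set R} (hr : r ∈ S) :
    (constantAlgorithm x₀ r).prob φ S = 1 := by
  change (∑ b : X × Unit, if r ∈ S then ‖(Pi.single (x₀, ()) 1 : X × Unit → ℂ) b‖ ^ 2 else 0) = 1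
  rw [Finset.sum_eq_single (x₀, ())]
  · simp [hr]
  · intro b _ hb
    simp [hb]
  · simp

theorem prob_nonneg (A : QueryAlgorithm X R) (φ : X → ℝ) (S : Set R) : 0 ≤ A.prob φ S :=
  Finset.sum_nonneg fun b _ => by split_ifs <;> positivity

theorem exists_perm_half_shift (m : ℕ) :
    ∃ σ : Equiv.Perm (Fin (2 ^ (m + 1))), ∀ k, |((σ k : ℕ) : ℝ) - ((k : ℕ) : ℝ)| = 2 ^ m := by
  have hlt : 2 ^ m < 2 ^ (m + 1) := Nat.pow_lt_pow_right (by norm_num) (by omega)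
  refine ⟨Equiv.addRight ⟨2 ^ m, hlt⟩, fun k => ?_⟩
  have h2 : 2 ^ (m + 1) = 2 * 2 ^ m := by ring
  have hk : (k : ℕ) < 2 * 2 ^ m := h2 ▸ k.isLt
  rw [Equiv.coe_addRight, Fin.val_add]
  change |(((k + 2 ^ m) % 2 ^ (m + 1) : ℕ) : ℝ) - ((k : ℕ) : ℝ)| = 2 ^ m
  rcases lt_or_ge (k : ℕ) (2 ^ m) with h | h
  · rw [Nat.mod_eq_of_lt (by omega)]
    push_cast
    rw [add_sub_cancel_left, abs_of_pos (by positivity)]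
  · rw [Nat.mod_eq_sub_mod (by omega), Nat.mod_eq_of_lt (by omega)]
    have : (k : ℕ) + 2 ^ m - 2 ^ (m + 1) = (k : ℕ) - 2 ^ m := by omega
    rw [this, Nat.cast_sub h]
    push_cast
    rw [sub_sub_cancel_left, abs_neg, abs_of_pos (by positivity)]

/-- A bounded function that is almost a quadratic form has a small matrix: moving along an edge of
the cube and by `1/2` along a coordinate of the grid gives a second difference equal to an entry of
the matrix. -/
theorem abs_entry_le_of_bounded {d n : ℕ} (hn : n ≠ 0) {H : Matrix (Fin d) (Fin d) ℝ}
    (hH : H.IsSymm) (c δ : ℝ) (φ : Label d n → ℝ)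
    (hφ : AlmostAll fun l => |φ l - quadraticValue H l - c| ≤ δ)
    (hb : ∀ l, φ l ∈ Set.Icc (-Real.pi) Real.pi) (i j : Fin d) :
    |H i j| ≤ 4 * Real.pi + 4 * δ := by
  obtain ⟨m, rfl⟩ := Nat.exists_eq_succ_of_ne_zero hn
  obtain ⟨σ, hσ⟩ := exists_perm_half_shift m
  let s : Equiv.Perm (Label d (m + 1)) := Equiv.prodCongr
    (Equiv.piCongrRight (Function.update (fun _ => Equiv.refl _) i σ)) (Equiv.refl _)
  obtain ⟨l, hl⟩ := exists_forall_of_almostAll hφ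
    ![Equiv.refl _, flipBit j, s, s.trans (flipBit j)]
  have h0 : |φ l - quadraticValue H l - c| ≤ δ := hl 0
  have h1 : |φ (flipBit j l) - quadraticValue H (flipBit j l) - c| ≤ δ := hl 1
  have h2 : |φ (s l) - quadraticValue H (s l) - c| ≤ δ := hl 2
  have h3 : |φ (flipBit j (s l)) - quadraticValue H (flipBit j (s l)) - c| ≤ δ := hl 3
  have hs2 : (s l).2 = l.2 := rfl
  have hs1 : ∀ i', i' ≠ i → (s l).1 i' = l.1 i' := by
    intro i' hi'
    simp [s, Function.update_of_ne hi']
  have hs1' : (s l).1 i = σ (l.1 i) := by simp [s]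
  have hdiff : (∑ i', H i' j * ((((s l).1 i' : ℕ) : ℝ) / 2 ^ (m + 1))) -
      ∑ i', H i' j * (((l.1 i' : ℕ) : ℝ) / 2 ^ (m + 1)) =
      H i j * ((((σ (l.1 i) : ℕ) : ℝ) - ((l.1 i : ℕ) : ℝ)) / 2 ^ (m + 1)) := by
    rw [← Finset.sum_sub_distrib, Finset.sum_eq_single i]
    · rw [hs1']
      ring
    · intro i' _ hi'
      rw [hs1 i' hi', sub_self]
    · simp
  have hq := quadraticValue_sub_flipBit hH l j
  have hq' := quadraticValue_sub_flipBit hH (s l) j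
  rw [hs2] at hq'
  have hD : (quadraticValue H (s l) - quadraticValue H (flipBit j (s l))) -
      (quadraticValue H l - quadraticValue H (flipBit j l)) = bitSign (l.2 j) * (2 *
        (H i j * ((((σ (l.1 i) : ℕ) : ℝ) - ((l.1 i : ℕ) : ℝ)) / 2 ^ (m + 1)))) := by
    rw [hq, hq', ← hdiff]
    ring
  have hsg : |bitSign (l.2 j)| = 1 := by cases l.2 j <;> simp [bitSign]
  have habs : |(quadraticValue H (s l) - quadraticValue H (flipBit j (s l))) -
      (quadraticValue H l - quadraticValue H (flipBit j l))| = |H i j| := by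
    rw [hD, abs_mul, hsg, one_mul, abs_mul, abs_mul, abs_div, hσ, abs_two,
      abs_of_pos (by positivity : (0 : ℝ) < 2 ^ (m + 1)), pow_succ]
    field_simp
  rw [← habs, abs_le]
  rw [abs_le] at h0 h1 h2 h3
  have b0 := hb l
  have b1 := hb (flipBit j l)
  have b2 := hb (s l)
  have b3 := hb (flipBit j (s l))
  rw [Set.mem_Icc] at b0 b1 b2 b3
  constructor <;> linarith [h0.1, h0.2, h1.1, h1.2, h2.1, h2.2, h3.1, h3.2]

end Guess

/-- The grid is fine enough for the frequencies of phase estimation not to wrap around. -/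
theorem le_two_pow_gridExponent {ε M : ℝ} (hε : 0 < ε) (hM : ε < M) :
    12 * (M / ε) ≤ ((2 ^ gridExponent ε M : ℕ) : ℝ) := by
  have hM0 : 0 < M := hε.trans hM
  have h1 := Int.le_ceil (Real.logb 2 (4 / ε))
  have h2 := Int.le_ceil (Real.logb 2 (3 * M))
  have h3 : Real.logb 2 (12 * (M / ε)) ≤ (gridExponent ε M : ℝ) := by
    have e : ((gridExponent ε M : ℤ) : ℝ) =
        ((⌈Real.logb 2 (4 / ε)⌉ + ⌈Real.logb 2 (3 * M)⌉ : ℤ) : ℝ) :=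
      congrArg _ (gridExponent_cast hε hM)
    push_cast at e
    rw [e, show 12 * (M / ε) = 4 / ε * (3 * M) by ring,
      Real.logb_mul (by positivity) (by positivity)]
    linarith
  rw [Real.logb_le_iff_le_rpow (by norm_num) (by positivity), Real.rpow_natCast] at h3
  exact_mod_cast h3

theorem sixteen_le_two_pow_gridExponent {ε M : ℝ} (hε : 0 < ε) (hM : ε < M) :
    16 ≤ 2 ^ gridExponent ε M := by
  have h1 := le_two_pow_gridExponent hε hM
  have h2 : 1 < M / ε := (one_lt_div hε).mpr hM
  have h3 : 12 < 2 ^ gridExponent ε M := by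
    have : (12 : ℝ) < ((2 ^ gridExponent ε M : ℕ) : ℝ) := by linarith
    exact_mod_cast this
  have h4 : 4 ≤ gridExponent ε M := by
    by_contra! h
    have := Nat.pow_le_pow_right (n := 2) (by norm_num) (Nat.le_of_lt_succ h)
    omega
  exact Nat.pow_le_pow_right (n := 2) (by norm_num) h4

/-- The entrywise estimate from the outcomes of `m` runs for each column. -/
noncomputable def medianEstimate {d n : ℕ} (q m : ℕ) (w : Fin d × Fin m → Label d n) :
    Matrix (Fin d) (Fin d) ℝ :=
  Matrix.of fun i j => median fun r =>
    bitSign ((w (j, r)).2 j) * (centeredRep ((w (j, r)).1 i) : ℝ) * Real.pi / q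

theorem sum_norm_runState_columnRun_sq {d n : ℕ} (φ : Label d n → ℝ) (q : ℕ) (j : Fin d)
    (U : Matrix.unitaryGroup (Label d n) ℂ) (l₀ : Label d n)
    (hU : U.1 *ᵥ Pi.single l₀ 1 = fun _ => uniformAmplitude d n) :
    ∑ l, ‖runState φ (columnRun q j U) (Pi.single l₀ 1) l‖ ^ 2 = 1 := by
  have hcard : (Fintype.card (Label d n) : ℝ) ≠ 0 := by exact_mod_cast Fintype.card_ne_zero
  have : ∀ l : Label d n, ‖Complex.exp (Complex.I * (q * (φ l - φ (flipBit j l)) : ℝ)) *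
      uniformAmplitude d n‖ ^ 2 = 1 / Fintype.card (Label d n) := fun l => by
    rw [norm_mul, mul_comm Complex.I, Complex.norm_exp_ofReal_mul_I, one_mul,
      norm_uniformAmplitude_sq]
  rw [runState_columnRun φ q j U l₀ hU, sum_norm_sq_unitary_mulVec,
    Finset.sum_congr rfl fun l _ => this l, Finset.sum_const, Finset.card_univ, nsmul_eq_mul,
    mul_one_div_cancel hcard]

/-- `m` runs for each column and entrywise medians determine the matrix, except with probability
`d² (999/1000)^m`. -/
theorem le_prob_medianEstimate {d n : ℕ} {H : Matrix (Fin d) (Fin d) ℝ} (hH : H.IsSymm) (c δ : ℝ)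
    (φ : Label d n → ℝ) (hφ : AlmostAll fun l => |φ l - quadraticValue H l - c| ≤ δ)
    (q m : ℕ) (hq : 0 < q) (hδ : 2 * q * δ ≤ 1 / 20)
    (hN : ∀ i j, q * |H i j| / Real.pi < ((2 ^ n : ℕ) : ℝ) / 2 - 1)
    (U : Matrix.unitaryGroup (Label d n) ℂ) (l₀ : Label d n)
    (hU : U.1 *ᵥ Pi.single l₀ 1 = fun _ => uniformAmplitude d n) :
    1 - d * d * (999 / 1000 : ℝ) ^ m ≤
      (independentRuns (fun t : Fin d × Fin m => columnRun q t.1 U) l₀ (medianEstimate q m)).prob φ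
        {H' | maxNorm (H' - H) ≤ Real.pi / q} := by
  classical
  rw [prob_independentRuns]
  have h := le_sum_majority (m := m)
    (fun j l => ‖runState φ (columnRun q j U) (Pi.single l₀ 1) l‖ ^ 2)
    (fun j l => by positivity)
    (fun j => sum_norm_runState_columnRun_sq φ q j U l₀ hU)
    (fun (i : Fin d) (j : Fin d) (l : Label d n) =>
      ¬ |bitSign (l.2 j) * (centeredRep (l.1 i) : ℝ) * Real.pi / q - H i j| ≤ Real.pi / q)
    (fun i j => by convert sum_bad_columnRun_le hH c δ φ hφ q hq hδ hN U l₀ hU i j)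
    (fun w => medianEstimate q m w ∈ {H' | maxNorm (H' - H) ≤ Real.pi / q})
    (fun w hw => by
      have hpos : 0 ≤ Real.pi / q := by positivity
      rw [Set.mem_ofPred_eq, maxNorm_le_iff hpos]
      intro i j
      refine abs_median_sub_le _ _ _ ?_
      convert hw i j)
  rw [Fintype.card_fin] at h
  convert h

/-- `2000 log (d / ρ)` runs make the union bound over the `d²` entries succeed. -/
theorem card_mul_pow_le {d : ℕ} {ρ : ℝ} (hd : 1 ≤ d) (hρ : 0 < ρ) (hρ1 : ρ ≤ 1) {m : ℕ}
    (hm : 2000 * Real.log (d / ρ) ≤ m) : d * d * (999 / 1000 : ℝ) ^ m ≤ ρ := by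
  have hd' : (0 : ℝ) < d := by exact_mod_cast hd
  have h1 : (999 / 1000 : ℝ) ≤ Real.exp (-(1 / 1000)) := by
    have := Real.add_one_le_exp (-(1 / 1000) : ℝ)
    linarith
  have h2 : (999 / 1000 : ℝ) ^ m ≤ (ρ / d) ^ 2 := by
    calc (999 / 1000 : ℝ) ^ m ≤ Real.exp (-(1 / 1000)) ^ m :=
          pow_le_pow_left₀ (by norm_num) h1 m
      _ = Real.exp (-((m : ℝ) / 1000)) := by
          rw [← Real.exp_nat_mul]
          congr 1
          ring
      _ ≤ Real.exp (-Real.log (d / ρ) + -Real.log (d / ρ)) := by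
          apply Real.exp_le_exp.mpr
          linarith
      _ = (ρ / d) ^ 2 := by
          rw [Real.exp_add, Real.exp_neg, Real.exp_log (by positivity), inv_div, sq]
  calc d * d * (999 / 1000 : ℝ) ^ m ≤ d * d * (ρ / d) ^ 2 := by gcongr
    _ = ρ * ρ := by field_simp
    _ ≤ ρ := mul_le_of_le_one_right hρ.le hρ1

end QuantumHessian

open QuantumHessian in
theorem proposition4p1 :
    ∃ C : ℝ, 0 < C ∧
      ∀ (d : ℕ) (ρ ε M : ℝ), 1 ≤ d → 0 < ρ → 0 < ε → ε < M →
        ∃ A : QuantumHessian.QueryAlgorithm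
            (QuantumHessian.Label d (QuantumHessian.gridExponent ε M))
            (Matrix (Fin d) (Fin d) ℝ),
          (A.queries : ℝ) ≤ C * ((d : ℝ) / ε) * max 1 (Real.log ((d : ℝ) / ρ)) ∧
          ∀ (H : Matrix (Fin d) (Fin d) ℝ) (c : ℝ) (h : (Fin d → ℝ) → ℝ),
            H.IsSymm → QuantumHessian.maxNorm H ≤ M →
            (ε < 8 ∨ ∀ l : QuantumHessian.Label d (QuantumHessian.gridExponent ε M),
              h (QuantumHessian.samplePoint l) ∈ Set.Icc (-Real.pi) Real.pi) →
            QuantumHessian.AlmostAll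
              (fun l : QuantumHessian.Label d (QuantumHessian.gridExponent ε M) =>
                |h (QuantumHessian.samplePoint l)
                    - QuantumHessian.samplePoint l ⬝ᵥ (H *ᵥ QuantumHessian.samplePoint l) - c|
                  ≤ ε / (8 * 42 * Real.pi)) →
            1 - ρ ≤ A.prob (fun l => h (QuantumHessian.samplePoint l))
              {H' | QuantumHessian.maxNorm (H' - H) ≤ ε} := by
  refine ⟨70000, by norm_num, fun d ρ ε M hd hρ hε hM => ?_⟩
  have hpi := Real.pi_pos
  have hpi3 := Real.pi_gt_d2
  have hpi4 := Real.pi_lt_d2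
  have hd' : (0 : ℝ) < d := by exact_mod_cast hd
  set L := max 1 (Real.log ((d : ℝ) / ρ)) with hL
  have hL1 : 1 ≤ L := le_max_left _ _
  have hLlog : Real.log ((d : ℝ) / ρ) ≤ L := le_max_right _ _
  have h12 := le_two_pow_gridExponent hε hM
  have h16 := sixteen_le_two_pow_gridExponent hε hM
  set n := gridExponent ε M
  let l₀ : Label d n := (fun _ => ⟨0, by positivity⟩, fun _ => false)
  have hbound : 0 ≤ 70000 * ((d : ℝ) / ε) * L := by positivity
  rcases le_or_gt 1 ρ with hρ1 | hρ1
  · refine ⟨constantAlgorithm l₀ 0, ?_, fun H c h _ _ _ _ => ?_⟩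
    · rw [queries_constantAlgorithm, Nat.cast_zero]
      exact hbound
    · exact (by linarith : 1 - ρ ≤ 0).trans (prob_nonneg _ _ _)
  -- Above the threshold `13 > 4π` the second difference bound already gives `|H i j| ≤ ε`; below it
  -- `d / ε` is large enough to absorb the rounding of the numbers of queries and of runs.
  rcases le_or_gt 13 ε with hε13 | hε13
  · refine ⟨constantAlgorithm l₀ 0, ?_, fun H c h hH _ h8 hφ => ?_⟩
    · rw [queries_constantAlgorithm, Nat.cast_zero]
      exact hbound
    · have hb := h8.resolve_left (by linarith)
      have hn : n ≠ 0 := by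
        intro h0
        rw [h0] at h16
        omega
      rw [prob_constantAlgorithm]
      · linarith
      · rw [Set.mem_ofPred_eq, maxNorm_le_iff hε.le]
        intro i j
        rw [Matrix.sub_apply, Matrix.zero_apply, zero_sub, abs_neg]
        have hij := abs_entry_le_of_bounded hn hH c _ (fun l => h (samplePoint l)) hφ hb i j
        have hδ : ε / (8 * 42 * Real.pi) ≤ ε / 1000 := by
          gcongr
          linarith
        linarith
  let q : ℕ := ⌈Real.pi / ε⌉₊
  have hq : 0 < q := Nat.ceil_pos.mpr (by positivity)
  have hq' : (0 : ℝ) < q := by exact_mod_cast hq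
  have hq1 : Real.pi / ε ≤ q := Nat.le_ceil _
  have hq2 : (q : ℝ) < Real.pi / ε + 1 := Nat.ceil_lt_add_one (by positivity)
  have hqε : q * ε < 17 := by
    have : q * ε < (Real.pi / ε + 1) * ε := mul_lt_mul_of_pos_right hq2 hε
    rw [add_mul, div_mul_cancel₀ _ hε.ne'] at this
    linarith
  have hπq : Real.pi / q ≤ ε := by
    rw [div_le_iff₀ hq']
    rw [div_le_iff₀ hε] at hq1
    linarith
  let m : ℕ := ⌈2000 * L⌉₊
  have hm1 : 2000 * L ≤ m := Nat.le_ceil _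
  have hm2 : (m : ℝ) < 2000 * L + 1 := Nat.ceil_lt_add_one (by positivity)
  obtain ⟨U, hU⟩ := exists_unitary_mulVec_single l₀ (fun _ => uniformAmplitude d n) (by
    have hcard : (Fintype.card (Label d n) : ℝ) ≠ 0 := by exact_mod_cast Fintype.card_ne_zero
    rw [Finset.sum_const, Finset.card_univ, norm_uniformAmplitude_sq, nsmul_eq_mul,
      mul_one_div_cancel hcard])
  refine ⟨independentRuns (fun t : Fin d × Fin m => columnRun q t.1 U) l₀ (medianEstimate q m),
    ?_, fun H c h hH hHM _ hφ => ?_⟩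
  · rw [queries_independentRuns]
    simp only [cost_columnRun, Finset.sum_const, Finset.card_univ, Fintype.card_prod,
      Fintype.card_fin, smul_eq_mul]
    push_cast
    have hqb : (q : ℝ) ≤ 17 / ε := (le_div_iff₀ hε).mpr hqε.le
    calc (d : ℝ) * m * (2 * q) ≤ d * (2001 * L) * (2 * (17 / ε)) := by
          gcongr
          linarith
      _ = 68034 * ((d : ℝ) / ε) * L := by ring
      _ ≤ 70000 * ((d : ℝ) / ε) * L := by
          gcongr
          norm_num
  · have hδ : 2 * q * (ε / (8 * 42 * Real.pi)) ≤ 1 / 20 := by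
      rw [mul_div_assoc', div_le_iff₀ (by positivity)]
      linarith
    have hN : ∀ i j, q * |H i j| / Real.pi < ((2 ^ n : ℕ) : ℝ) / 2 - 1 := by
      intro i j
      have hij : |H i j| ≤ M := (maxNorm_le_iff (hε.trans hM).le).mp hHM i j
      have h16' : (16 : ℝ) ≤ ((2 ^ n : ℕ) : ℝ) := by exact_mod_cast h16
      set N : ℝ := ((2 ^ n : ℕ) : ℝ)
      have hM' : M ≤ N / 12 * ε := by
        rw [← div_le_iff₀ hε]
        linarith
      rw [div_lt_iff₀ hpi]
      calc q * |H i j| ≤ q * (N / 12 * ε) := by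
            gcongr
            exact hij.trans hM'
        _ = N / 12 * (q * ε) := by ring
        _ ≤ N / 12 * (Real.pi + ε) := by
            gcongr
            have : q * ε < (Real.pi / ε + 1) * ε := mul_lt_mul_of_pos_right hq2 hε
            rw [add_mul, div_mul_cancel₀ _ hε.ne', one_mul] at this
            exact this.le
        -- This uses `ε < 13` and `16 ≤ N`.
        _ < (N / 2 - 1) * Real.pi := by nlinarith
    have hprob := le_prob_medianEstimate hH c _ (fun l => h (samplePoint l)) hφ q m hq hδ hN U l₀ hU
    have hfail := card_mul_pow_le hd hρ hρ1.le (m := m) (by linarith)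
    have hmono : ∀ A : QueryAlgorithm (Label d n) (Matrix (Fin d) (Fin d) ℝ), ∀ φ,
        A.prob φ {H' | maxNorm (H' - H) ≤ Real.pi / q} ≤ A.prob φ {H' | maxNorm (H' - H) ≤ ε} := by
      intro A φ
      refine Finset.sum_le_sum fun b _ => ?_
      by_cases h1 : A.output b ∈ {H' | maxNorm (H' - H) ≤ Real.pi / q}
      · have h2 : A.output b ∈ {H' | maxNorm (H' - H) ≤ ε} := le_trans h1 hπq
        rw [if_pos h1, if_pos h2]
      · rw [if_neg h1]
        split_ifs <;> positivity
    exact le_trans (by linarith) (hprob.trans (hmono _ _))
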